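/- Let $\overline{\mathbb Q}$ be the field of algebraic numbers, and let $h$ be the projective (Fubini–Study) height on $\mathbb P^N(\overline{\mathbb Q})$: if $K$ is a number field containing $\xi_0,\dots,\xi_N$, then $$h(\xi_0:\cdots:\xi_N)=\sum_{v\mid\infty}\frac{[K_v:\mathbb Q_v]}{[K:\mathbb Q]}\log\sqrt{|\xi_0|_v^2+\cdots+|\xi_N|_v^2}+\sum_{v\nmid\infty}\frac{[K_v:\mathbb Q_v]}{[K:\mathbb Q]}\log\max\{|\xi_0|_v,\dots,|\xi_N|_v\},$$ where the absolute values $|\cdot|_v$ extend the standard ones of $\mathbb Q$. For a quasi-projective variety $V\subset\mathbb P^N$ of dimension $r$ and $1\le i\le r+1$, the $i$-th successive minimum of $V$ is $$\mu_i(V)=\sup_W\ \inf\{h(\xi)\,:\,\xi\in V\setminus W\},$$ where $W$ runs over all closed, not necessarily irreducible, subvarieties of $V$ of codimension $i$ (that is, of dimension $r-i$, with the convention $\dim\emptyset=-1$). The essential minimum is $\mu^{\mathrm{ess}}(V)=\mu_1(V)$ and the absolute minimum is $\mu^{\mathrm{abs}}(V)=\mu_{r+1}(V)$. Let $\mathcal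 A=\{a_0,\dots,a_N\}\subset\mathbb Z^n$ be a finite set of $N+1$ distinct vectors ($N\ge 0$), and let $X_{\mathcal A}\subset\mathbb P^N$ be the Zariski closure of $\{(t^{a_0}:\cdots:t^{a_N})\,:\,t\in(\overline{\mathbb Q}^\times)^n\}$. Let $r$ be the dimension of $\mathcal A$, that is, the rank of the subgroup of $\mathbb Z^n$ generated by the differences of elements of $\mathcal A$; it is also the dimension of $X_{\mathcal A}$. For $0\le j\le r$ let $$N_{\mathcal A}(j)=\min\{\operatorname{Card}(P\cap\mathcal A)\,:\,P\text{ a face of }\operatorname{Conv}(\mathcal A)\subset\mathbb R^n,\ \dim P=j\},$$ where $\operatorname{Conv}(\mathcal A)$ counts as a face of itself. Then $$\mu_i(X_{\mathcal A})=\tfrac12\log N_{\mathcal A}(r-i+1)\qquad(i=1,\dots,r+1).$$ In particular $\mu^{\mathrm{ess}}(X_{\mathcal A})=\tfrac12\log(N+1)$ and $\mu^{\mathrm{abs}}(X_{\mathcal A})=0$. -/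

import Mathlib

noncomputable section

namespace ToricMinima

/-- The field of algebraic numbers. -/
abbrev Qbar : Type := AlgebraicClosure ℚ

/-- The set of points of projective `N`-space over the field of algebraic numbers. -/
abbrev ProjSpace (N : ℕ) : Type := Projectivization Qbar (Fin (N + 1) → Qbar)

/-! ### The Zariski topology and dimension -/

/-- The set of common zeros in projective space of a set of homogeneous polynomials (whether a
homogeneous polynomial vanishes does not depend on the choice of homogeneous coordinates). -/
def zeroLocus {N : ℕ} (S : Set (MvPolynomial (Fin (N + 1)) Qbar)) : Set (ProjSpace N) :=
  {x | ∀ f ∈ S, MvPolynomial.eval x.rep f = 0}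

/-- A set of projective space is algebraic if it is the set of common zeros of a set of
homogeneous polynomials. -/
def IsAlgebraicSet {N : ℕ} (Z : Set (ProjSpace N)) : Prop :=
  ∃ S : Set (MvPolynomial (Fin (N + 1)) Qbar),
    (∀ f ∈ S, ∃ d : ℕ, f.IsHomogeneous d) ∧ Z = zeroLocus S

/-- The Zariski topology: the closed sets are the algebraic sets. -/
instance zariskiTopology (N : ℕ) : TopologicalSpace (ProjSpace N) :=
  TopologicalSpace.ofClosed {Z | IsAlgebraicSet Z}
    (by
      refine ⟨{1}, ?_, ?_⟩
      · rintro f rfl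
        exact ⟨0, MvPolynomial.isHomogeneous_one _ _⟩
      · ext x
        simp [zeroLocus])
    (by
      intro A hA
      refine ⟨{f | (∃ d : ℕ, f.IsHomogeneous d) ∧
        ∃ Z ∈ A, ∀ x ∈ Z, MvPolynomial.eval (Projectivization.rep x) f = 0},
        fun f hf => hf.1, ?_⟩
      ext x
      constructor
      · rintro hx f ⟨-, Z, hZ, hf⟩
        exact hf x (hx Z hZ)
      · intro hx Z hZ
        obtain ⟨S, hS, rfl⟩ := hA hZ
        intro f hf
        exact hx f ⟨hS f hf, _, hZ, fun y hy => hy f hf⟩)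
    (by
      rintro _ ⟨S, hS, rfl⟩ _ ⟨T, hT, rfl⟩
      refine ⟨{f | ∃ g ∈ S, ∃ h ∈ T, f = g * h}, ?_, ?_⟩
      · rintro _ ⟨g, hg, h, hh, rfl⟩
        obtain ⟨d, hd⟩ := hS g hg
        obtain ⟨e, he⟩ := hT h hh
        exact ⟨d + e, hd.mul he⟩
      · ext x
        constructor
        · rintro (hx | hx) _ ⟨g, hg, h, hh, rfl⟩
          · simp [hx g hg]
          · simp [hx h hh]
        · intro hx
          by_contra hcon
          rw [Set.mem_union, not_or] at hcon
          obtain ⟨h1, h2⟩ := hcon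
          simp only [zeroLocus, Set.mem_ofPred_eq, not_forall] at h1 h2
          obtain ⟨g, hg, hg0⟩ := h1
          obtain ⟨h, hh, hh0⟩ := h2
          have := hx _ ⟨g, hg, h, hh, rfl⟩
          rw [map_mul, mul_eq_zero] at this
          exact this.elim hg0 hh0)

open Classical in
/-- The dimension of a subset of projective space for the Zariski topology: the maximal length
of a chain of irreducible closed subsets, with the convention `dim ∅ = -1`. (It is at most `N`, so
that `toNat` loses nothing.) -/
def zdim {N : ℕ} (V : Set (ProjSpace N)) : ℤ :=
  if V = ∅ then -1 else (((topologicalKrullDim V).unbotD 0).toNat : ℤ)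

/-- `W` is a (not necessarily irreducible) Zariski closed subvariety of `V`, of codimension `i`
in `V`; in particular the empty subvariety has codimension `dim V + 1`. -/
def IsSubvarietyOfCodim {N : ℕ} (V W : Set (ProjSpace N)) (i : ℕ) : Prop :=
  (∃ Z : Set (ProjSpace N), IsClosed Z ∧ W = V ∩ Z) ∧ zdim W + i = zdim V

/-! ### The projective height -/

/-- The projective height of a nonzero vector `x` with coordinates in a number field `K`, with the
Euclidean norm at the archimedean places. For an infinite place, `v.mult` is the local degree
`[K_v : ℝ]`; for a finite place over a prime `p`, Mathlib's normalization `v x = (N 𝔭) ^ (-ord x)`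
is the `[K_v : ℚ_p]`-th power of the absolute value that extends the `p`-adic one, so the local
degree is already there. -/
def heightOver (K : Type*) [Field K] [NumberField K] {N : ℕ} (x : Fin (N + 1) → K) : ℝ :=
  ((∑ v : NumberField.InfinitePlace K, (v.mult : ℝ) * Real.log (Real.sqrt (∑ i, v (x i) ^ 2)))
    + ∑ᶠ v : NumberField.FinitePlace K, Real.log (⨆ i, v (x i))) / (Module.finrank ℚ K : ℝ)

/-- The number field generated by the coordinates of a vector. -/
abbrev coordField {N : ℕ} (x : Fin (N + 1) → Qbar) : IntermediateField ℚ Qbar :=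
  IntermediateField.adjoin ℚ (Set.range x)

instance numberField_coordField {N : ℕ} (x : Fin (N + 1) → Qbar) :
    NumberField (coordField x) where
  to_charZero := inferInstance
  to_finiteDimensional :=
    haveI : Finite (Set.range x) := Set.finite_range x
    haveI : Algebra.IsAlgebraic ℚ Qbar := by
      convert AlgebraicClosure.isAlgebraic ℚ
      · rfl
      · exact Subsingleton.elim _ _
    IntermediateField.finiteDimensional_adjoin fun y _ =>
      (Algebra.IsAlgebraic.isAlgebraic (R := ℚ) y).isIntegral

/-- The projective height of a point, computed on a vector of homogeneous coordinates over the
number field that these generate (the value depends neither on the coordinates, by the product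
formula, nor on the field). -/
def height {N : ℕ} (ξ : ProjSpace N) : ℝ :=
  heightOver (coordField ξ.rep)
    (fun i => ⟨ξ.rep i, IntermediateField.subset_adjoin ℚ _ (Set.mem_range_self i)⟩)

/-! ### Successive minima -/

/-- The `i`-th successive minimum of `V`: the supremum, over the subvarieties `W` of `V` of
codimension `i`, of the infimum of the height on `V \ W`. The supremum and the infimum are taken
in the extended reals. -/
def successiveMinimum {N : ℕ} (V : Set (ProjSpace N)) (i : ℕ) : EReal :=
  ⨆ (W : Set (ProjSpace N)) (_ : IsSubvarietyOfCodim V W i),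
    ⨅ (ξ : ProjSpace N) (_ : ξ ∈ V \ W), (height ξ : EReal)

/-- The essential minimum. -/
def essentialMinimum {N : ℕ} (V : Set (ProjSpace N)) : EReal :=
  successiveMinimum V 1

/-- The absolute minimum: the successive minimum of index `dim V + 1`. -/
def absoluteMinimum {N : ℕ} (V : Set (ProjSpace N)) : EReal :=
  successiveMinimum V (zdim V + 1).toNat

/-! ### Projective toric varieties -/

/-- The monomial `t ^ b = t_1 ^ b_1 ⋯ t_n ^ b_n` at a point `t` of the torus. -/
def monomial {n : ℕ} (t : Fin n → Qbarˣ) (b : Fin n → ℤ) : Qbarˣ :=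
  ∏ j, t j ^ b j

/-- The monomial map `t ↦ (t ^ a_0 : ⋯ : t ^ a_N)` from the torus to projective space. -/
def monomialMap {n N : ℕ} (a : Fin (N + 1) → Fin n → ℤ) (t : Fin n → Qbarˣ) : ProjSpace N :=
  Projectivization.mk Qbar (fun i => (monomial t (a i) : Qbar))
    (fun h => (monomial t (a 0)).ne_zero (congrFun h 0))

/-- The projective toric variety of `a_0, …, a_N`: the Zariski closure of the image of the
monomial map. -/
def toricVariety {n N : ℕ} (a : Fin (N + 1) → Fin n → ℤ) : Set (ProjSpace N) :=
  closure (Set.range (monomialMap a))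

/-- The submodule of `ℤ^n` generated by the differences of the vectors `a_0, …, a_N`. -/
def differenceLattice {n N : ℕ} (a : Fin (N + 1) → Fin n → ℤ) : Submodule ℤ (Fin n → ℤ) :=
  Submodule.span ℤ {b | ∃ i k, b = a i - a k}

/-- The dimension of `{a_0, …, a_N}`: the rank of its lattice of differences. -/
def latticeDim {n N : ℕ} (a : Fin (N + 1) → Fin n → ℤ) : ℕ :=
  Module.finrank ℤ (differenceLattice a)

/-- The set `{a_0, …, a_N}` as a subset of `ℝ^n`. -/
def realPoints {n N : ℕ} (a : Fin (N + 1) → Fin n → ℤ) : Set (Fin n → ℝ) :=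
  Set.range fun i j => (a i j : ℝ)

/-- The polytope of `{a_0, …, a_N}`. -/
def polytope {n N : ℕ} (a : Fin (N + 1) → Fin n → ℤ) : Set (Fin n → ℝ) :=
  convexHull ℝ (realPoints a)

/-- `P` is a nonempty face of the polytope: the set of its points where some linear functional
attains its maximum on the polytope (the zero functional gives the polytope itself). -/
def IsFace {n N : ℕ} (a : Fin (N + 1) → Fin n → ℤ) (P : Set (Fin n → ℝ)) : Prop :=
  P.Nonempty ∧ IsExposed ℝ (polytope a) P

/-- `N_A(k)`: the least number of points of `{a_0, …, a_N}` that lie on a `k`-dimensional face of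
the polytope. -/
def minFaceCard {n N : ℕ} (a : Fin (N + 1) → Fin n → ℤ) (k : ℕ) : ℕ :=
  sInf {m | ∃ P : Set (Fin n → ℝ), IsFace a P ∧ Module.finrank ℝ (vectorSpan ℝ P) = k ∧
    m = (P ∩ realPoints a).ncard}

end ToricMinima

end

/-!
The toric variety `X` of `a_0, …, a_N` is the disjoint union of the torus orbits of the faces of
the polytope: the support of a point of `X`, that is, the set of indices of its nonzero
coordinates, is the set of the `a_i` on a face (`isIndexFace_coordSupport`), and every face occurs
(`facePoint_mem_toricVariety`).

The height of a point is controlled by the size `m` of its support. Applying the inequality between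
the arithmetic and the geometric mean at each archimedean place, and bounding a maximum below by an
average of logarithms at each finite place, one obtains from the product formula that the height is
at least `(log m) / 2` (`half_log_card_le_heightOver`). Equality holds if the ratios of the nonzero
coordinates are roots of unity (`heightOver_eq_half_log_card`), in particular at the torsion points
of the orbits.

Let `r` be the dimension of `X`. For the lower bound on the `i`-th minimum one removes from `X` the
closed set `smallOrbits` of the orbits of dimension less than `j = r + 1 - i`, which has codimension
`i`; the support of a remaining point contains a `j`-dimensional face
(`IsIndexFace.exists_subface`), hence at least `N_A(j)` elements. For the upper bound one takes a
`j`-dimensional face with `N_A(j)` points. A closed subset of dimension `j - 1` cannot contain all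
torsion points of its orbit, because the closure of these points has dimension at least `j`
(`affineDim_le_topologicalKrullDim`).

The dimension of a closed subset of `X` is bounded above through the transcendence degree of the
homogeneous coordinate rings of its irreducible subsets, which increases strictly along chains and
is bounded by the rank of the exponents because the coordinates satisfy binomial equations
(`coneTrdeg_le`). It is bounded below by an explicit chain, the closures of the torsion points of a
flag of subtori.
-/

noncomputable section

namespace ToricMinima

/-! ### Heights -/

section Height

open NumberField

variable {K : Type*} [Field K] [NumberField K] {N : ℕ}

/-- The product formula in additive form. -/
theorem sum_log_infinitePlace_add_finsum_log_finitePlace {y : K} (hy : y ≠ 0) :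
    (∑ v : InfinitePlace K, (v.mult : ℝ) * Real.log (v y)) +
      ∑ᶠ v : FinitePlace K, Real.log (v y) = 0 := by
  have h := congrArg Real.log (prod_abs_eq_one hy)
  have hfin : (fun w : FinitePlace K => w y).mulSupport.Finite :=
    FinitePlace.hasFiniteMulSupport hy
  have hpos : ∀ w : FinitePlace K, 0 < w y := fun w => FinitePlace.pos_iff.2 hy
  rw [Real.log_one, finprod_eq_prod _ hfin, Real.log_mul, Real.log_prod, Real.log_prod] at h
  · rw [finsum_eq_sum_of_support_subset (s := hfin.toFinset)]
    · simpa using h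
    · intro w hw
      simp only [Function.mem_support] at hw
      simp only [Set.Finite.coe_toFinset, Function.mem_mulSupport]
      intro h1
      simp [h1] at hw
  · exact fun w _ => (hpos w).ne'
  · exact fun w _ => pow_ne_zero _ (by simpa using hy)
  · exact Finset.prod_ne_zero_iff.2 fun w _ => pow_ne_zero _ (by simpa using hy)
  · exact Finset.prod_ne_zero_iff.2 fun w _ => (hpos w).ne'

theorem finite_support_log_finitePlace {y : K} (hy : y ≠ 0) :
    (Function.support fun v : FinitePlace K => Real.log (v y)).Finite := by
  refine (FinitePlace.hasFiniteMulSupport hy).subset fun w hw => ?_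
  simp only [Function.mem_support] at hw
  simp only [Function.mem_mulSupport]
  intro h1
  simp [h1] at hw

theorem finite_support_log_iSup_finitePlace {x : Fin (N + 1) → K} (hx : x ≠ 0) :
    (Function.support fun v : FinitePlace K => Real.log (⨆ i, v (x i))).Finite := by
  obtain ⟨k, hk⟩ := Function.ne_iff.1 hx
  have : (⋃ i ∈ {i | x i ≠ 0},
      Function.mulSupport fun v : FinitePlace K => v (x i)).Finite :=
    (Set.toFinite _).biUnion fun i hi => FinitePlace.hasFiniteMulSupport hi
  refine this.subset fun v hv => ?_
  by_contra hcon
  simp only [Set.mem_iUnion, Function.mem_mulSupport, not_exists, not_not] at hcon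
  have : (⨆ i, v (x i)) = 1 := by
    apply le_antisymm
    · refine ciSup_le fun i => ?_
      by_cases hi : x i = 0
      · simp [hi]
      · exact (hcon i hi).le
    · rw [← hcon k hk]
      exact le_ciSup (f := fun i => v (x i)) (Set.finite_range _).bddAbove k
  simp [this] at hv

/-- The height of a vector is at least half the logarithm of the number of its nonzero
coordinates: at each infinite place this is the inequality between the arithmetic and the geometric
mean, and the product formula disposes of the geometric means. -/
theorem half_log_card_le_heightOver {x : Fin (N + 1) → K} (hx : x ≠ 0) {S : Finset (Fin (N + 1))}
    (hS : ∀ i, i ∈ S ↔ x i ≠ 0) : 1 / 2 * Real.log S.card ≤ heightOver K x := by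
  obtain ⟨k, hk⟩ := Function.ne_iff.1 hx
  have hkS : k ∈ S := (hS k).2 hk
  have hm : (0 : ℝ) < S.card := by exact_mod_cast Finset.card_pos.2 ⟨k, hkS⟩
  have hd : (0 : ℝ) < Module.finrank ℚ K := by exact_mod_cast Module.finrank_pos
  have hinf : ∀ v : InfinitePlace K,
      1 / 2 * Real.log S.card + (S.card : ℝ)⁻¹ * ∑ i ∈ S, Real.log (v (x i)) ≤
        Real.log (Real.sqrt (∑ i, v (x i) ^ 2)) := by
    intro v
    have hpos : ∀ i ∈ S, 0 < v (x i) := fun i hi => InfinitePlace.pos_iff.2 ((hS i).1 hi)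
    have hsum : ∑ i, v (x i) ^ 2 = ∑ i ∈ S, v (x i) ^ 2 := by
      refine (Finset.sum_subset (Finset.subset_univ S) fun i _ hi => ?_).symm
      rw [hS, not_not] at hi
      simp [hi]
    have hpos' : 0 < ∑ i ∈ S, v (x i) ^ 2 :=
      Finset.sum_pos (fun i hi => pow_pos (hpos i hi) 2) ⟨k, hkS⟩
    have hj := strictConcaveOn_log_Ioi.concaveOn.le_map_sum (t := S)
      (w := fun _ => (S.card : ℝ)⁻¹) (p := fun i => v (x i) ^ 2)
      (fun _ _ => by positivity) (by simp [hm.ne']) (fun i hi => pow_pos (hpos i hi) 2)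
    simp only [smul_eq_mul, ← Finset.mul_sum, Real.log_pow] at hj
    rw [Real.log_mul (by positivity) hpos'.ne', Real.log_inv] at hj
    rw [hsum, Real.log_sqrt hpos'.le]
    push_cast at hj
    linarith
  have hfin : (S.card : ℝ)⁻¹ * ∑ i ∈ S, ∑ᶠ v : FinitePlace K, Real.log (v (x i)) ≤
      ∑ᶠ v : FinitePlace K, Real.log (⨆ i, v (x i)) := by
    rw [← finsum_sum_comm S (fun (v : FinitePlace K) i => Real.log (v (x i)))
      fun i hi => finite_support_log_finitePlace ((hS i).1 hi), mul_finsum _ ]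
    · refine finsum_le_finsum' ?_ (finite_support_log_iSup_finitePlace hx) ?_
      · refine (S.finite_toSet.biUnion fun i hi =>
          finite_support_log_finitePlace ((hS i).1 hi)).subset fun v hv => ?_
        by_contra hcon
        simp only [Set.mem_iUnion, Function.mem_support, not_exists, not_not] at hcon
        exact hv (by simp only; rw [Finset.sum_eq_zero hcon, mul_zero])
      · intro v
        have : ∑ i ∈ S, Real.log (v (x i)) ≤ S.card • Real.log (⨆ i, v (x i)) := by
          refine Finset.sum_le_card_nsmul _ _ _ fun i hi => ?_
          exact Real.log_le_log (FinitePlace.pos_iff.2 ((hS i).1 hi))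
            (le_ciSup (f := fun i => v (x i)) (Set.finite_range _).bddAbove i)
        rw [nsmul_eq_mul] at this
        simp only
        rwa [inv_mul_le_iff₀ hm]
  have hprod : ∑ i ∈ S, ((∑ v : InfinitePlace K, (v.mult : ℝ) * Real.log (v (x i))) +
      ∑ᶠ v : FinitePlace K, Real.log (v (x i))) = 0 :=
    Finset.sum_eq_zero fun i hi =>
      sum_log_infinitePlace_add_finsum_log_finitePlace ((hS i).1 hi)
  rw [Finset.sum_add_distrib, Finset.sum_comm] at hprod
  have hmult : (∑ v : InfinitePlace K, (v.mult : ℝ)) = Module.finrank ℚ K := by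
    exact_mod_cast InfinitePlace.sum_mult_eq (K := K)
  have hinf' : ∑ v : InfinitePlace K, (v.mult : ℝ) *
      (1 / 2 * Real.log S.card + (S.card : ℝ)⁻¹ * ∑ i ∈ S, Real.log (v (x i))) ≤
      ∑ v : InfinitePlace K, (v.mult : ℝ) * Real.log (Real.sqrt (∑ i, v (x i) ^ 2)) :=
    Finset.sum_le_sum fun v _ => mul_le_mul_of_nonneg_left (hinf v) (Nat.cast_nonneg _)
  have hexp : ∑ v : InfinitePlace K, (v.mult : ℝ) *
      (1 / 2 * Real.log S.card + (S.card : ℝ)⁻¹ * ∑ i ∈ S, Real.log (v (x i))) =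
      (Module.finrank ℚ K : ℝ) * (1 / 2 * Real.log S.card) + (S.card : ℝ)⁻¹ *
        ∑ v : InfinitePlace K, ∑ i ∈ S, (v.mult : ℝ) * Real.log (v (x i)) := by
    rw [← hmult, Finset.sum_mul, Finset.mul_sum, ← Finset.sum_add_distrib]
    refine Finset.sum_congr rfl fun v _ => ?_
    rw [← Finset.mul_sum]
    ring
  rw [heightOver, le_div_iff₀ hd]
  have : (S.card : ℝ)⁻¹ * (∑ v : InfinitePlace K, ∑ i ∈ S, (v.mult : ℝ) * Real.log (v (x i))) +
      (S.card : ℝ)⁻¹ * ∑ i ∈ S, ∑ᶠ v : FinitePlace K, Real.log (v (x i)) = 0 := by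
    rw [← mul_add, hprod, mul_zero]
  linarith

/-- If the ratios of the nonzero coordinates of a vector are roots of unity, then its height is
half the logarithm of the number of these coordinates. -/
theorem heightOver_eq_half_log_card {x : Fin (N + 1) → K} {k : Fin (N + 1)} (hk : x k ≠ 0)
    {S : Finset (Fin (N + 1))} (hS : ∀ i, i ∈ S ↔ x i ≠ 0) {e : ℕ} (he : e ≠ 0)
    (hroot : ∀ i ∈ S, x i ^ e = x k ^ e) : heightOver K x = 1 / 2 * Real.log S.card := by
  have hkS : k ∈ S := (hS k).2 hk
  have hm : (0 : ℝ) < S.card := by exact_mod_cast Finset.card_pos.2 ⟨k, hkS⟩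
  have hd : (0 : ℝ) < Module.finrank ℚ K := by exact_mod_cast Module.finrank_pos
  have hinf : ∀ v : InfinitePlace K,
      Real.log (Real.sqrt (∑ i, v (x i) ^ 2)) = 1 / 2 * Real.log S.card + Real.log (v (x k)) := by
    intro v
    have hsum : ∑ i, v (x i) ^ 2 = S.card * v (x k) ^ 2 := by
      rw [← Finset.sum_subset (Finset.subset_univ S), ← nsmul_eq_mul, ← Finset.sum_const]
      · refine Finset.sum_congr rfl fun i hi => ?_
        have := congrArg v (hroot i hi)
        rw [map_pow, map_pow, pow_left_inj₀ (apply_nonneg _ _) (apply_nonneg _ _) he] at this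
        rw [this]
      · intro i _ hi
        rw [hS, not_not] at hi
        simp [hi]
    have hv : 0 < v (x k) := InfinitePlace.pos_iff.2 hk
    rw [hsum, Real.log_sqrt (by positivity), Real.log_mul hm.ne' (by positivity), Real.log_pow]
    push_cast
    ring
  have hfin : ∀ v : FinitePlace K, (⨆ i, v (x i)) = v (x k) := by
    intro v
    apply le_antisymm
    · refine ciSup_le fun i => ?_
      by_cases hi : x i = 0
      · simp only [hi, map_zero]
        exact apply_nonneg _ _
      · have := congrArg v (hroot i ((hS i).2 hi))
        rw [map_pow, map_pow, pow_left_inj₀ (apply_nonneg _ _) (apply_nonneg _ _) he] at this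
        exact this.le
    · exact le_ciSup (f := fun i => v (x i)) (Set.finite_range _).bddAbove k
  have hmult : (∑ v : InfinitePlace K, (v.mult : ℝ)) = Module.finrank ℚ K := by
    exact_mod_cast InfinitePlace.sum_mult_eq (K := K)
  have hp := sum_log_infinitePlace_add_finsum_log_finitePlace hk
  rw [heightOver, div_eq_iff hd.ne']
  simp only [hinf, hfin, mul_add, Finset.sum_add_distrib, ← Finset.sum_mul, hmult]
  linarith

end Height

section Projective

variable {N : ℕ}

open Classical in
/-- The set of indices of the nonzero homogeneous coordinates of a point. -/
def coordSupport (ξ : ProjSpace N) : Finset (Fin (N + 1)) :=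
  Finset.univ.filter fun i => ξ.rep i ≠ 0

@[simp]
theorem mem_coordSupport {ξ : ProjSpace N} {i : Fin (N + 1)} :
    i ∈ coordSupport ξ ↔ ξ.rep i ≠ 0 := by
  simp [coordSupport]

theorem coordSupport_nonempty (ξ : ProjSpace N) : (coordSupport ξ).Nonempty := by
  obtain ⟨k, hk⟩ := Function.ne_iff.1 ξ.rep_nonzero
  exact ⟨k, mem_coordSupport.2 hk⟩

theorem half_log_card_coordSupport_le_height (ξ : ProjSpace N) :
    1 / 2 * Real.log (coordSupport ξ).card ≤ height ξ := by
  refine half_log_card_le_heightOver ?_ fun i => ?_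
  · obtain ⟨k, hk⟩ := Function.ne_iff.1 ξ.rep_nonzero
    exact Function.ne_iff.2 ⟨k, fun h => hk (congrArg Subtype.val h)⟩
  · rw [mem_coordSupport, not_iff_not, Subtype.ext_iff]
    rfl

theorem height_eq_half_log_card {ξ : ProjSpace N} {k : Fin (N + 1)} (hk : ξ.rep k ≠ 0) {e : ℕ}
    (he : e ≠ 0) (hroot : ∀ i, ξ.rep i ≠ 0 → ξ.rep i ^ e = ξ.rep k ^ e) :
    height ξ = 1 / 2 * Real.log (coordSupport ξ).card := by
  refine heightOver_eq_half_log_card (k := k) (fun h => hk (congrArg Subtype.val h))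
    (fun i => ?_) he fun i hi => ?_
  · rw [mem_coordSupport, not_iff_not, Subtype.ext_iff]
    rfl
  · exact Subtype.ext (hroot i (mem_coordSupport.1 hi))

end Projective

/-! ### Transcendence degree and the Zariski dimension -/

universe u

attribute [local instance] MvPolynomial.gradedAlgebra

/-- A proper quotient of a domain of finite transcendence degree has smaller transcendence
degree. -/
theorem trdeg_lt_of_surjective_of_not_injective {k : Type*} {A B : Type u} [Field k] [CommRing A]
    [CommRing B] [IsDomain A] [IsDomain B] [Algebra k A] [Algebra k B] (f : A →ₐ[k] B)
    (hf : Function.Surjective f) (hf' : ¬ Function.Injective f)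
    (hA : Algebra.trdeg k A < Cardinal.aleph0) :
    (Algebra.trdeg k B).toNat < (Algebra.trdeg k A).toNat := by
  obtain ⟨s, hs⟩ := exists_isTranscendenceBasis k B
  choose g hg using hf
  have hy : AlgebraicIndependent k fun b : s => g b := by
    refine AlgebraicIndependent.of_comp f ?_
    convert hs.1 using 1
    funext b
    exact hg b
  have hcard := hs.cardinalMk_eq_trdeg
  have hlt : Cardinal.mk s < Cardinal.aleph0 := hy.cardinalMk_le_trdeg.trans_lt hA
  have hfin : Finite s := Cardinal.lt_aleph0_iff_finite.1 hlt
  rw [← hcard]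
  by_contra hge
  have hle : Algebra.trdeg k A ≤ Cardinal.mk s := by
    rwa [not_lt, Cardinal.toNat_le_iff_le_of_lt_aleph0 hA hlt] at hge
  refine hf' ?_
  have hbasis : IsTranscendenceBasis k fun b : s => g b :=
    hy.isTranscendenceBasis_of_trdeg_le_of_finite hle
  -- A nonzero element `x` of the kernel divides a nonzero polynomial in the elements `g b`, whose
  -- image in `B` is zero although the images of the `g b` are algebraically independent.
  have halg := hbasis.isAlgebraic
  rw [injective_iff_map_eq_zero]
  intro x hx
  by_contra hx0
  obtain ⟨r, hr, q, hq⟩ := (halg.isAlgebraic x).exists_nonzero_dvd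
    (mem_nonZeroDivisors_of_ne_zero hx0)
  have hr' : f r = 0 := by
    rw [show (r : A) = x * q from hq, map_mul, hx, zero_mul]
  have hmem : (r : A) ∈ (MvPolynomial.aeval (R := k) fun b : s => g b).range := by
    rw [← Algebra.adjoin_range_eq_range_aeval]
    exact r.2
  obtain ⟨p, hp⟩ := hmem
  have hp0 : MvPolynomial.aeval (fun b : s => (b : B)) p = 0 := by
    rw [← hr', ← hp]
    simp only [AlgHom.toRingHom_eq_coe, RingHom.coe_coe]
    rw [← AlgHom.comp_apply, MvPolynomial.comp_aeval]
    simp [hg]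
  have := (algebraicIndependent_iff.1 hs.1) p hp0
  rw [this] at hp
  exact hr (Subtype.ext (by simpa using hp.symm))

variable {n N : ℕ}

theorem isClosed_iff_isAlgebraicSet {Z : Set (ProjSpace N)} : IsClosed Z ↔ IsAlgebraicSet Z := by
  rw [← isOpen_compl_iff]
  change Zᶜᶜ ∈ {Z | IsAlgebraicSet Z} ↔ _
  rw [compl_compl]
  rfl

theorem eval_smul_of_isHomogeneous {f : MvPolynomial (Fin (N + 1)) Qbar} {d : ℕ}
    (hf : f.IsHomogeneous d) (c : Qbar) (y : Fin (N + 1) → Qbar) :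
    MvPolynomial.eval (c • y) f = c ^ d * MvPolynomial.eval y f := by
  rw [MvPolynomial.eval_eq', MvPolynomial.eval_eq', Finset.mul_sum]
  refine Finset.sum_congr rfl fun u hu => ?_
  have hd : ∑ i, u i = d := by
    rw [← hf (MvPolynomial.mem_support_iff.1 hu), Finsupp.weight_apply,
      Finsupp.sum_fintype _ _ (by simp)]
    simp
  simp only [Pi.smul_apply, smul_eq_mul, mul_pow, Finset.prod_mul_distrib,
    Finset.prod_pow_eq_pow_sum, hd]
  ring

theorem eval_smul_eq_sum (f : MvPolynomial (Fin (N + 1)) Qbar) (c : Qbar) (y : Fin (N + 1) → Qbar) :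
    MvPolynomial.eval (c • y) f = ∑ d ∈ Finset.range (f.totalDegree + 1),
      c ^ d * MvPolynomial.eval y (MvPolynomial.homogeneousComponent d f) := by
  conv_lhs => rw [← MvPolynomial.sum_homogeneousComponent f]
  rw [map_sum]
  exact Finset.sum_congr rfl fun d _ =>
    eval_smul_of_isHomogeneous (MvPolynomial.homogeneousComponent_isHomogeneous d f) c y

/-- The ideal of the polynomials that vanish on the affine cone over a subset of projective
space. -/
def coneIdeal (Z : Set (ProjSpace N)) : Ideal (MvPolynomial (Fin (N + 1)) Qbar) where
  carrier := {f | ∀ x ∈ Z, ∀ c : Qbar, MvPolynomial.eval (c • x.rep) f = 0}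
  add_mem' hf hg x hx c := by rw [map_add, hf x hx, hg x hx, add_zero]
  zero_mem' x _ c := map_zero _
  smul_mem' r f hf x hx c := by rw [smul_eq_mul, map_mul, hf x hx, mul_zero]

theorem mem_coneIdeal {Z : Set (ProjSpace N)} {f : MvPolynomial (Fin (N + 1)) Qbar} :
    f ∈ coneIdeal Z ↔ ∀ x ∈ Z, ∀ c : Qbar, MvPolynomial.eval (c • x.rep) f = 0 :=
  Iff.rfl

theorem mem_coneIdeal_of_isHomogeneous {Z : Set (ProjSpace N)}
    {f : MvPolynomial (Fin (N + 1)) Qbar} {d : ℕ} (hf : f.IsHomogeneous d) :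
    f ∈ coneIdeal Z ↔ ∀ x ∈ Z, MvPolynomial.eval x.rep f = 0 := by
  refine ⟨fun h x hx => by simpa using h x hx 1, fun h x hx c => ?_⟩
  rw [eval_smul_of_isHomogeneous hf, h x hx, mul_zero]

theorem isHomogeneous_coneIdeal (Z : Set (ProjSpace N)) :
    (coneIdeal Z).IsHomogeneous (MvPolynomial.homogeneousSubmodule (Fin (N + 1)) Qbar) := by
  intro i f hf
  rw [show ((DirectSum.decompose (MvPolynomial.homogeneousSubmodule (Fin (N + 1)) Qbar) f i :
      MvPolynomial (Fin (N + 1)) Qbar)) = MvPolynomial.homogeneousComponent i f from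
      MvPolynomial.decomposition.decompose'_apply f i]
  rw [mem_coneIdeal_of_isHomogeneous (MvPolynomial.homogeneousComponent_isHomogeneous i f)]
  intro x hx
  -- The values of `f` on the line through `x.rep` form a polynomial in the parameter of the line,
  -- with the values of the homogeneous components as coefficients.
  let p : Polynomial Qbar := ∑ d ∈ Finset.range (f.totalDegree + 1),
      Polynomial.monomial d (MvPolynomial.eval x.rep (MvPolynomial.homogeneousComponent d f))
  have hp : p = 0 := by
    refine Polynomial.funext fun c => ?_
    have := hf x hx c
    rw [eval_smul_eq_sum] at this
    simp only [p, Polynomial.eval_finsetSum, Polynomial.eval_monomial, Polynomial.eval_zero]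
    rw [← this]
    exact Finset.sum_congr rfl fun d _ => mul_comm _ _
  by_cases hi : i < f.totalDegree + 1
  · have := congrArg (fun q => Polynomial.coeff q i) hp
    simpa [p, Polynomial.coeff_monomial, Finset.sum_ite_eq, hi] using this
  · rw [MvPolynomial.homogeneousComponent_eq_zero _ _ (by omega), map_zero]

theorem isPrime_coneIdeal {Z : Set (ProjSpace N)} (hZ : IsIrreducible Z) :
    (coneIdeal Z).IsPrime := by
  refine (isHomogeneous_coneIdeal Z).isPrime_of_homogeneous_mem_or_mem ?_ ?_
  · obtain ⟨x, hx⟩ := hZ.nonempty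
    rw [Ideal.ne_top_iff_one]
    intro h
    simpa using h x hx 1
  · rintro f g ⟨d, hd⟩ ⟨e, he⟩ hfg
    rw [MvPolynomial.mem_homogeneousSubmodule] at hd he
    by_contra! hcon
    rw [mem_coneIdeal_of_isHomogeneous hd, mem_coneIdeal_of_isHomogeneous he] at hcon
    have hcl : ∀ {f : MvPolynomial (Fin (N + 1)) Qbar} {d : ℕ}, f.IsHomogeneous d →
        IsOpen {x : ProjSpace N | MvPolynomial.eval x.rep f ≠ 0} := by
      intro f d hf
      have : IsClosed (zeroLocus {f} : Set (ProjSpace N)) :=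
        isClosed_iff_isAlgebraicSet.2 ⟨{f}, by simpa using ⟨d, hf⟩, rfl⟩
      convert this.isOpen_compl using 1
      ext x
      simp [zeroLocus]
    push Not at hcon
    obtain ⟨⟨x, hx, hx'⟩, ⟨y, hy, hy'⟩⟩ := hcon
    obtain ⟨z, hz, hz1, hz2⟩ := hZ.2 _ _ (hcl hd) (hcl he) ⟨x, hx, hx'⟩ ⟨y, hy, hy'⟩
    have := (mem_coneIdeal_of_isHomogeneous (hd.mul he)).1 hfg z hz
    rw [map_mul, mul_eq_zero] at this
    exact this.elim hz1 hz2

theorem coneIdeal_anti {Z Z' : Set (ProjSpace N)} (h : Z ⊆ Z') : coneIdeal Z' ≤ coneIdeal Z :=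
  fun _ hf x hx => hf x (h hx)

theorem subset_of_coneIdeal_le {Z Z' : Set (ProjSpace N)} (hZ : IsClosed Z)
    (h : coneIdeal Z ≤ coneIdeal Z') : Z' ⊆ Z := by
  obtain ⟨S, hS, rfl⟩ := isClosed_iff_isAlgebraicSet.1 hZ
  intro x hx f hf
  obtain ⟨d, hd⟩ := hS f hf
  exact (mem_coneIdeal_of_isHomogeneous hd).1
    (h ((mem_coneIdeal_of_isHomogeneous hd).2 fun y hy => hy f hf)) x hx

/-- The dimension of the affine cone over a subset of projective space, as the transcendence
degree of its coordinate ring. -/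
def coneTrdeg (Z : Set (ProjSpace N)) : ℕ :=
  (Algebra.trdeg Qbar (MvPolynomial (Fin (N + 1)) Qbar ⧸ coneIdeal Z)).toNat

theorem coneTrdeg_lt {Z Z' : Set (ProjSpace N)} (hZ : IsIrreducible Z) (hZc : IsClosed Z)
    (hZ' : IsIrreducible Z') (hss : Z ⊂ Z') : coneTrdeg Z < coneTrdeg Z' := by
  have := isPrime_coneIdeal hZ
  have := isPrime_coneIdeal hZ'
  refine trdeg_lt_of_surjective_of_not_injective
    (Ideal.Quotient.factorₐ Qbar (coneIdeal_anti hss.1))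
    (Ideal.Quotient.factor_surjective (coneIdeal_anti hss.1)) ?_
    (trdeg_lt_aleph0_of_finiteType)
  intro hinj
  refine hss.2 (subset_of_coneIdeal_le hZc fun f hf => ?_)
  rw [← Ideal.Quotient.eq_zero_iff_mem] at hf ⊢
  exact hinj (by simpa using hf)

theorem coneTrdeg_pos {Z : Set (ProjSpace N)} (hZ : IsIrreducible Z) : 0 < coneTrdeg Z := by
  have := isPrime_coneIdeal hZ
  rw [coneTrdeg, Nat.pos_iff_ne_zero, Ne, Cardinal.toNat_eq_zero, not_or, not_le]
  refine ⟨fun h => ?_, trdeg_lt_aleph0_of_finiteType⟩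
  rw [trdeg_eq_zero_iff] at h
  -- A coordinate that is nonzero at a point of `Z` takes all values on the cone, so that it is
  -- transcendental.
  obtain ⟨x, hx⟩ := hZ.nonempty
  obtain ⟨k, hk⟩ := Function.ne_iff.1 x.rep_nonzero
  obtain ⟨p, hp, hp'⟩ := h.isAlgebraic
    (Ideal.Quotient.mkₐ Qbar (coneIdeal Z) (MvPolynomial.X k))
  rw [Polynomial.aeval_algHom_apply, Ideal.Quotient.mkₐ_eq_mk,
    Ideal.Quotient.eq_zero_iff_mem] at hp'
  refine hp (Polynomial.funext fun c => ?_)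
  have := hp' x hx (c / x.rep k)
  rw [← MvPolynomial.coe_aeval_eq_eval, RingHom.coe_coe, ← Polynomial.aeval_algHom_apply] at this
  simpa [div_mul_cancel₀ c hk, Polynomial.coe_aeval_eq_eval] using this

/-! ### Points of a toric variety -/

theorem monomial_add (t : Fin n → Qbarˣ) (b c : Fin n → ℤ) :
    monomial t (b + c) = monomial t b * monomial t c := by
  simp [monomial, zpow_add, Finset.prod_mul_distrib]

/-- Evaluation at a point of the torus as a homomorphism from the lattice of exponents. -/
def monomialHom (t : Fin n → Qbarˣ) : Multiplicative (Fin n → ℤ) →* Qbarˣ where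
  toFun b := monomial t b.toAdd
  map_one' := by simp [monomial]
  map_mul' b c := by simp [monomial_add]

theorem prod_monomial_pow (t : Fin n → Qbarˣ) {ι : Type*} (s : Finset ι) (u : ι → ℕ)
    (b : ι → Fin n → ℤ) :
    ∏ i ∈ s, monomial t (b i) ^ u i = monomial t (∑ i ∈ s, u i • b i) := by
  have := map_prod (monomialHom t) (fun i => Multiplicative.ofAdd (b i) ^ u i) s
  simp only [map_pow] at this
  have h : monomial t (∑ i ∈ s, u i • b i) = monomialHom t
      (∏ i ∈ s, Multiplicative.ofAdd (b i) ^ u i) := by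
    change _ = monomial t _
    congr 1
  rw [h, this]
  rfl

theorem isClosed_toricVariety (a : Fin (N + 1) → Fin n → ℤ) : IsClosed (toricVariety a) :=
  isClosed_closure

theorem eval_eq_zero_of_mem_closure {S : Set (ProjSpace N)} {f : MvPolynomial (Fin (N + 1)) Qbar}
    {d : ℕ} (hf : f.IsHomogeneous d) (hS : ∀ x ∈ S, MvPolynomial.eval x.rep f = 0) {ξ : ProjSpace N}
    (hξ : ξ ∈ closure S) : MvPolynomial.eval ξ.rep f = 0 := by
  have hcl : IsClosed (zeroLocus {f} : Set (ProjSpace N)) :=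
    isClosed_iff_isAlgebraicSet.2 ⟨{f}, by simpa using ⟨d, hf⟩, rfl⟩
  exact closure_minimal (t := zeroLocus {f}) (fun x hx g hg => by rw [hg]; exact hS x hx)
    hcl hξ f rfl

/-- Whether a homogeneous polynomial vanishes at a point can be read off from any homogeneous
coordinates. -/
theorem eval_rep_mk {f : MvPolynomial (Fin (N + 1)) Qbar} {d : ℕ} (hf : f.IsHomogeneous d)
    {y : Fin (N + 1) → Qbar} (hy : y ≠ 0) :
    MvPolynomial.eval (Projectivization.mk Qbar y hy).rep f = 0 ↔ MvPolynomial.eval y f = 0 := by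
  obtain ⟨c, hc⟩ := Projectivization.exists_smul_eq_mk_rep Qbar y hy
  rw [← hc, Units.smul_def, eval_smul_of_isHomogeneous hf]
  simp

/-- The homogeneous coordinates of a point of the toric variety satisfy the binomial equations
given by the affine relations between the exponents. -/
theorem prod_rep_pow_eq {a : Fin (N + 1) → Fin n → ℤ} {ξ : ProjSpace N} (hξ : ξ ∈ toricVariety a)
    {ι : Type*} [Fintype ι] (f : ι → Fin (N + 1)) (u v : ι → ℕ) (h1 : ∑ b, u b = ∑ b, v b)
    (h2 : ∑ b, u b • a (f b) = ∑ b, v b • a (f b)) :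
    ∏ b, ξ.rep (f b) ^ u b = ∏ b, ξ.rep (f b) ^ v b := by
  have hom : ∀ w : ι → ℕ, (∏ b, (MvPolynomial.X (f b) : MvPolynomial (Fin (N + 1)) Qbar) ^
      w b).IsHomogeneous (∑ b, w b) := fun w => MvPolynomial.IsHomogeneous.prod _ _ _ fun b _ => by
    simpa using (MvPolynomial.isHomogeneous_X Qbar (f b)).pow (w b)
  have hg := (hom u).sub (h1 ▸ hom v)
  have := eval_eq_zero_of_mem_closure hg (S := Set.range (monomialMap a)) ?_ hξ
  · simpa [MvPolynomial.eval_prod, sub_eq_zero] using this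
  · rintro _ ⟨t, rfl⟩
    rw [monomialMap, eval_rep_mk hg]
    have key : ∀ w : ι → ℕ, ∏ b, (monomial t (a (f b)) : Qbar) ^ w b =
        (monomial t (∑ b, w b • a (f b)) : Qbarˣ) := fun w => by
      rw [← prod_monomial_pow]
      simp
    simp only [map_sub, map_prod, map_pow, MvPolynomial.eval_X]
    rw [key, key, h2, sub_self]

/-- The vector `a_i` as a point of `ℝ^n`. -/
def realPoint (a : Fin (N + 1) → Fin n → ℤ) (i : Fin (N + 1)) : Fin n → ℝ := fun j => (a i j : ℝ)

/-- The dimension of the affine hull of the points `a_i`, for `i` in a set of indices. -/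
def affineDim (a : Fin (N + 1) → Fin n → ℤ) (S : Set (Fin (N + 1))) : ℕ :=
  Module.finrank ℝ (vectorSpan ℝ (realPoint a '' S))

theorem affineDim_mono (a : Fin (N + 1) → Fin n → ℤ) {S T : Set (Fin (N + 1))} (h : S ⊆ T) :
    affineDim a S ≤ affineDim a T :=
  Submodule.finrank_mono (vectorSpan_mono ℝ (Set.image_mono h))

/-- Lattice points without a nontrivial integral affine relation are affinely independent over the
real numbers. -/
theorem affineIndependent_of_int {a : Fin (N + 1) → Fin n → ℤ} {ι : Type*} [Fintype ι]
    (f : ι → Fin (N + 1))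
    (h : ∀ w : ι → ℤ, ∑ b, w b = 0 → ∑ b, w b • a (f b) = 0 → w = 0) :
    AffineIndependent ℝ fun b => realPoint a (f b) := by
  have hZ : LinearIndependent ℤ fun b => (Fin.cons 1 (a (f b)) : Fin (n + 1) → ℤ) := by
    rw [Fintype.linearIndependent_iff]
    intro w hw
    refine congrFun (h w ?_ ?_)
    · simpa using congrFun hw 0
    · ext j
      simpa using congrFun hw j.succ
  have hR := (linearIndependent_algebraMap_comp_iff (S := ℝ)).2 hZ
  rw [Fintype.linearIndependent_iff] at hR
  rw [affineIndependent_iff_of_fintype]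
  intro w hw hw'
  refine hR w ?_
  rw [Finset.univ.weightedVSub_eq_linear_combination hw] at hw'
  ext j
  refine Fin.cases ?_ (fun j => ?_) j
  · simpa using hw
  · simpa [realPoint] using congrFun hw' j

theorem exists_isTranscendenceBasis_subset_of_adjoin_eq_top {k A : Type*} [Field k] [CommRing A]
    [IsDomain A] [Algebra k A] {s : Set A} (hs : Algebra.adjoin k s = ⊤) :
    ∃ t ⊆ s, IsTranscendenceBasis k ((↑) : t → A) := by
  have : Algebra.IsAlgebraic (Algebra.adjoin k s) A :=
    ⟨fun y => isAlgebraic_algebraMap (⟨y, hs ▸ Algebra.mem_top⟩ : Algebra.adjoin k s)⟩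
  exact exists_isTranscendenceBasis_subset s

/-- If all points of an irreducible subset `Z` of the toric variety have supports of affine
dimension at most `d`, then the affine cone over `Z` has dimension at most `d + 1`: its coordinate
ring is generated by the coordinate functions that do not vanish on `Z`, and an affine relation
between exponents yields an algebraic relation between these. -/
theorem coneTrdeg_le {a : Fin (N + 1) → Fin n → ℤ} {Z : Set (ProjSpace N)} (hZ : IsIrreducible Z)
    (hZa : Z ⊆ toricVariety a) {d : ℕ} (hd : ∀ x ∈ Z, affineDim a (coordSupport x) ≤ d) :
    coneTrdeg Z ≤ d + 1 := by
  classical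
  have hprime := isPrime_coneIdeal hZ
  -- The set of the coordinates that do not vanish identically on `Z`; they are all nonzero at some
  -- point of `Z`.
  let T : Finset (Fin (N + 1)) := Finset.univ.filter fun i => MvPolynomial.X i ∉ coneIdeal Z
  have hT : affineDim a T ≤ d := by
    have hprod : (∏ i ∈ T, MvPolynomial.X i) ∉ coneIdeal Z := by
      rw [hprime.prod_mem_iff]
      rintro ⟨i, hi, hi'⟩
      exact (Finset.mem_filter.1 hi).2 hi'
    rw [mem_coneIdeal] at hprod
    push Not at hprod
    obtain ⟨x, hx, c, hc⟩ := hprod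
    rw [map_prod, Finset.prod_ne_zero_iff] at hc
    refine (affineDim_mono a fun i hi => ?_).trans (hd x hx)
    have := hc i hi
    simp only [MvPolynomial.eval_X, Pi.smul_apply, smul_eq_mul] at this
    exact Finset.mem_coe.2 (mem_coordSupport.2 (right_ne_zero_of_mul this))
  let q := Ideal.Quotient.mkₐ Qbar (coneIdeal Z)
  let s : Set (MvPolynomial (Fin (N + 1)) Qbar ⧸ coneIdeal Z) :=
    (fun i => q (MvPolynomial.X i)) '' T
  have hs : Algebra.adjoin Qbar s = ⊤ := by
    rw [eq_top_iff]
    rintro y -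
    obtain ⟨f, rfl⟩ := Ideal.Quotient.mkₐ_surjective Qbar (coneIdeal Z) y
    induction f using MvPolynomial.induction_on with
    | C c => exact Subalgebra.algebraMap_mem _ c
    | add f g hf hg => rw [map_add]; exact Subalgebra.add_mem _ hf hg
    | mul_X f i hf =>
      rw [map_mul]
      refine Subalgebra.mul_mem _ hf ?_
      by_cases hi : i ∈ T
      · exact Algebra.subset_adjoin ⟨i, hi, rfl⟩
      · have : MvPolynomial.X i ∈ coneIdeal Z := by simpa [T] using hi
        rw [Ideal.Quotient.mkₐ_eq_mk, Ideal.Quotient.eq_zero_iff_mem.2 this]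
        exact Subalgebra.zero_mem _
  obtain ⟨t, hts, ht⟩ := exists_isTranscendenceBasis_subset_of_adjoin_eq_top hs
  have hts' : ∀ y ∈ t, ∃ i ∈ T, q (MvPolynomial.X i) = y := fun y hy => hts hy
  choose! g hgT hg using hts'
  have : Finite t := ((T.finite_toSet.image _).subset hts).to_subtype
  have : Fintype t := Fintype.ofFinite t
  have hind : AffineIndependent ℝ fun b : t => realPoint a (g b) := by
    refine affineIndependent_of_int (fun b : t => g b) fun w hw hw' => ?_
    -- Separate the positive and the negative coefficients of an affine relation.
    have hsplit : ∀ b, w b = ((w b).toNat : ℤ) - ((-w b).toNat : ℤ) := fun b => by omega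
    have h1 : ∑ b, (w b).toNat = ∑ b, (-w b).toNat := by
      have : ∑ b, (((w b).toNat : ℤ) - ((-w b).toNat : ℤ)) = 0 := by simpa [← hsplit] using hw
      rw [Finset.sum_sub_distrib, sub_eq_zero] at this
      exact_mod_cast this
    have h2 : ∑ b, (w b).toNat • a (g b) = ∑ b, (-w b).toNat • a (g b) := by
      have : ∑ b, (((w b).toNat : ℤ) - ((-w b).toNat : ℤ)) • a (g b) = 0 := by
        simpa only [← hsplit] using hw'
      simp only [sub_smul, Finset.sum_sub_distrib, sub_eq_zero, natCast_zsmul] at this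
      exact this
    have hmem : (∏ b : t, MvPolynomial.X (g b) ^ (w b).toNat) -
        (∏ b : t, MvPolynomial.X (g b) ^ (-w b).toNat) ∈ coneIdeal Z := by
      intro x hx c
      simp only [map_sub, map_prod, map_pow, MvPolynomial.eval_X, Pi.smul_apply, smul_eq_mul,
        mul_pow, Finset.prod_mul_distrib, Finset.prod_pow_eq_pow_sum]
      rw [prod_rep_pow_eq (hZa hx) (fun b : t => g b) _ _ h1 h2, h1, sub_self]
    have hrel : MvPolynomial.aeval
        (fun b : t => (b : MvPolynomial (Fin (N + 1)) Qbar ⧸ coneIdeal Z))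
        ((∏ b : t, MvPolynomial.X b ^ (w b).toNat) - ∏ b : t, MvPolynomial.X b ^ (-w b).toNat :
          MvPolynomial t Qbar) = 0 := by
      rw [← Ideal.Quotient.eq_zero_iff_mem, ← Ideal.Quotient.mkₐ_eq_mk Qbar] at hmem
      rw [← hmem]
      simp only [map_sub, map_prod, map_pow, MvPolynomial.aeval_X]
      congr 1 <;> exact Finset.prod_congr rfl fun b _ =>
        congrArg (· ^ _) (hg b b.2).symm
    have hzero := algebraicIndependent_iff.1 ht.1 _ hrel
    rw [sub_eq_zero] at hzero
    have hmon : ∀ u : t → ℕ, (∏ b, MvPolynomial.X b ^ u b : MvPolynomial t Qbar) =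
        MvPolynomial.monomial (Finsupp.equivFunOnFinite.symm u) 1 := fun u => by
      rw [MvPolynomial.monomial_eq]
      simp [Finsupp.prod_fintype]
    rw [hmon, hmon, MvPolynomial.monomial_left_inj one_ne_zero] at hzero
    funext b
    have := congrFun (Finsupp.equivFunOnFinite.symm.injective hzero) b
    rw [hsplit b, this, sub_self]
    rfl
  have hcard := hind.card_le_finrank_succ
  have hrange : Module.finrank ℝ (vectorSpan ℝ (Set.range fun b : t => realPoint a (g b))) ≤ d := by
    refine le_trans (Submodule.finrank_mono (vectorSpan_mono ℝ ?_)) hT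
    rintro _ ⟨b, rfl⟩
    exact ⟨g b, hgT b b.2, rfl⟩
  rw [coneTrdeg, ← ht.cardinalMk_eq_trdeg, Cardinal.mk_fintype, Cardinal.toNat_natCast]
  exact hcard.trans (by omega)

/-! ### The dimension of closed subsets -/

/-- A closed subset of the toric variety has at most the maximal affine dimension of the supports of
its points, because the dimension of the affine cone increases strictly along a chain of irreducible
closed sets. -/
theorem topologicalKrullDim_le {a : Fin (N + 1) → Fin n → ℤ} {W : Set (ProjSpace N)}
    (hW : IsClosed W) (hWa : W ⊆ toricVariety a) {d : ℕ}
    (hd : ∀ x ∈ W, affineDim a (coordSupport x) ≤ d) : topologicalKrullDim W ≤ d := by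
  refine iSup_le fun p => ?_
  let e : TopologicalSpace.IrreducibleCloseds W →
      TopologicalSpace.IrreducibleCloseds (ProjSpace N) :=
    TopologicalSpace.IrreducibleCloseds.map _ continuous_subtype_val
  have he : StrictMono e :=
    TopologicalSpace.IrreducibleCloseds.map_strictMono_of_isInducing .subtypeVal
  have hmono : StrictMono fun c : TopologicalSpace.IrreducibleCloseds W =>
      coneTrdeg (e c : Set (ProjSpace N)) :=
    fun c c' h => coneTrdeg_lt (e c).isIrreducible (e c).isClosed (e c').isIrreducible (he h)
  have hlen := (p.map _ hmono).head_add_length_le_nat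
  have hsub : (e p.last : Set (ProjSpace N)) ⊆ W :=
    closure_minimal (by rintro _ ⟨x, -, rfl⟩; exact x.2) hW
  have hlast : coneTrdeg (e p.last : Set (ProjSpace N)) ≤ d + 1 :=
    coneTrdeg_le (e p.last).isIrreducible (hsub.trans hWa) fun x hx => hd x (hsub hx)
  have hhead : 0 < coneTrdeg (e p.head : Set (ProjSpace N)) :=
    coneTrdeg_pos (e p.head).isIrreducible
  simp only [LTSeries.head_map, LTSeries.last_map, LTSeries.map_length] at hlen
  have : p.length ≤ d := by omega
  exact_mod_cast this

theorem zdim_le_of_topologicalKrullDim_le {W : Set (ProjSpace N)} {d : ℕ}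
    (h : topologicalKrullDim W ≤ d) : zdim W ≤ d := by
  rw [zdim]
  split_ifs
  · omega
  · generalize topologicalKrullDim W = x at h
    cases x with
    | bot => simp
    | coe x =>
      have hx : x ≤ d := by exact_mod_cast h
      rw [WithBot.unbotD_coe]
      exact_mod_cast ENat.toNat_le_of_le_natCast hx

theorem le_zdim_of_le_topologicalKrullDim {W : Set (ProjSpace N)} {d j : ℕ}
    (h : topologicalKrullDim W ≤ d) (hj : j ≤ topologicalKrullDim W) (hW : W.Nonempty) :
    (j : ℤ) ≤ zdim W := by
  rw [zdim, if_neg hW.ne_empty]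
  generalize topologicalKrullDim W = x at h hj
  cases x with
  | bot => simp at hj
  | coe x =>
    have hx : x ≤ d := by exact_mod_cast h
    have hx' : (j : ℕ∞) ≤ x := by exact_mod_cast hj
    lift x to ℕ using ne_top_of_le_ne_top (ENat.natCast_ne_top d) hx
    rw [WithBot.unbotD_coe, ENat.toNat_natCast]
    exact_mod_cast hx'

/-- A chain of irreducible sets with strictly increasing closures in a closed set `W` bounds the
dimension of `W` from below. -/
theorem natCast_le_topologicalKrullDim {W : Set (ProjSpace N)} (hW : IsClosed W) {j : ℕ}
    (S : ℕ → Set (ProjSpace N)) (hS : ∀ k, IsIrreducible (S k)) (hSW : ∀ k, S k ⊆ W)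
    (hmono : ∀ k < j, closure (S k) ⊂ closure (S (k + 1))) : (j : ℕ∞) ≤ topologicalKrullDim W := by
  have hcl : ∀ k, closure (S k) ⊆ W := fun k => closure_minimal (hSW k) hW
  let c : ℕ → TopologicalSpace.IrreducibleCloseds W := fun k =>
    { carrier := Subtype.val ⁻¹' closure (S k)
      isIrreducible' := by
        have hirr := (hS k).closure
        constructor
        · obtain ⟨x, hx⟩ := hirr.nonempty
          exact ⟨⟨x, hcl k hx⟩, hx⟩
        · rintro _ _ ⟨u, hu, rfl⟩ ⟨v, hv, rfl⟩ ⟨x, hx, hx'⟩ ⟨y, hy, hy'⟩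
          obtain ⟨z, hz, hz'⟩ := hirr.2 u v hu hv ⟨x, hx, hx'⟩ ⟨y, hy, hy'⟩
          exact ⟨⟨z, hcl k hz⟩, hz, hz'⟩
      isClosed' := isClosed_closure.preimage continuous_subtype_val }
  let p : LTSeries (TopologicalSpace.IrreducibleCloseds W) :=
    { length := j
      toFun := fun i => c i
      step := fun i => by
        have h := hmono i i.2
        refine ⟨fun x hx => h.1 hx, fun hle => h.2 fun x hx => ?_⟩
        exact hle (show (⟨x, hcl _ hx⟩ : W) ∈ c (i + 1) from hx) }
  exact Order.LTSeries.length_le_krullDim p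

/-! ### The orbits of the faces -/

/-- Distinct exponents give distinct, hence linearly independent, characters of the torus: the
coefficients of a combination of monomials that vanishes on the torus cancel for each exponent. -/
theorem sum_mul_comp_eq_zero {ι : Type*} (s : Finset ι) (c : ι → Qbar) (w : ι → Fin n → ℤ)
    (h : ∀ t : Fin n → Qbarˣ, ∑ i ∈ s, c i * (monomial t (w i) : Qbar) = 0)
    (ψ : (Fin n → ℤ) → Qbar) : ∑ i ∈ s, c i * ψ (w i) = 0 := by
  classical
  let χ : (Fin n → ℤ) → (Fin n → Qbarˣ) →* Qbar := fun b =>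
    (Units.coeHom Qbar).comp
      { toFun := fun t => monomial t b
        map_one' := by simp [monomial]
        map_mul' := fun t t' => by simp [monomial, mul_zpow, Finset.prod_mul_distrib] }
  have hχ : ∀ b t, χ b t = (monomial t b : Qbar) := fun b t => rfl
  have hinj : Function.Injective χ := by
    intro b b' hb
    funext j
    have h2 : (2 : Qbar) ≠ 0 := two_ne_zero
    have := DFunLike.congr_fun hb (Pi.mulSingle j (Units.mk0 2 h2))
    rw [hχ, hχ] at this
    have key : ∀ b : Fin n → ℤ,
        (monomial (Pi.mulSingle j (Units.mk0 (2 : Qbar) h2)) b : Qbar) = ((2 : ℚ) ^ b j : ℚ) := by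
      intro b
      rw [monomial, Finset.prod_eq_single j]
      · simp
      · intro k _ hk
        simp [hk]
      · simp
    rw [key, key, Rat.cast_inj] at this
    exact zpow_right_injective₀ (by norm_num) (by norm_num) this
  have hli := (linearIndependent_monoidHom (Fin n → Qbarˣ) Qbar).comp χ hinj
  rw [linearIndependent_iff'] at hli
  have hfib : ∀ g : (Fin n → ℤ) → Qbar, ∑ i ∈ s, c i * g (w i) =
      ∑ b ∈ s.image w, (∑ i ∈ s with w i = b, c i) * g b := by
    intro g
    rw [← Finset.sum_fiberwise_of_maps_to (fun i hi => Finset.mem_image_of_mem w hi)]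
    refine Finset.sum_congr rfl fun b _ => ?_
    rw [Finset.sum_mul]
    exact Finset.sum_congr rfl fun i hi => by rw [(Finset.mem_filter.1 hi).2]
  have hcoef := hli (s.image w) (fun b => ∑ i ∈ s with w i = b, c i) (by
    funext t
    have := h t
    rw [hfib fun b => (monomial t b : Qbar)] at this
    simpa [hχ] using this)
  rw [hfib]
  exact Finset.sum_eq_zero fun b hb => by rw [hcoef b hb, zero_mul]

/-- A set of indices is a face if it consists of the indices at which some real linear functional
attains its maximum on the vectors `a_i`. -/
def IsIndexFace (a : Fin (N + 1) → Fin n → ℤ) (F : Finset (Fin (N + 1))) : Prop :=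
  F.Nonempty ∧ ∃ (l : (Fin n → ℝ) →ₗ[ℝ] ℝ) (m : ℝ), (∀ i, l (realPoint a i) ≤ m) ∧
    ∀ i, i ∈ F ↔ l (realPoint a i) = m

/-- The point with coordinates `t ^ a_i` for `i` in `F` and zero for the other indices. -/
def facePoint (a : Fin (N + 1) → Fin n → ℤ) {F : Finset (Fin (N + 1))} (hF : F.Nonempty)
    (t : Fin n → Qbarˣ) : ProjSpace N :=
  Projectivization.mk Qbar (fun i => if i ∈ F then (monomial t (a i) : Qbar) else 0) fun h => by
    obtain ⟨i, hi⟩ := hF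
    simpa [hi] using congrFun h i

theorem exists_rep_facePoint (a : Fin (N + 1) → Fin n → ℤ) {F : Finset (Fin (N + 1))}
    (hF : F.Nonempty) (t : Fin n → Qbarˣ) : ∃ c : Qbar, c ≠ 0 ∧ ∀ i, (facePoint a hF t).rep i =
      c * if i ∈ F then (monomial t (a i) : Qbar) else 0 := by
  obtain ⟨c, hc⟩ := Projectivization.exists_smul_eq_mk_rep Qbar
    (fun i => if i ∈ F then (monomial t (a i) : Qbar) else 0) (fun h => by
      obtain ⟨i, hi⟩ := hF
      simpa [hi] using congrFun h i)
  exact ⟨c, c.ne_zero, fun i => (congrFun hc i).symm⟩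

theorem coordSupport_facePoint (a : Fin (N + 1) → Fin n → ℤ) {F : Finset (Fin (N + 1))}
    (hF : F.Nonempty) (t : Fin n → Qbarˣ) : coordSupport (facePoint a hF t) = F := by
  obtain ⟨c, hc, h⟩ := exists_rep_facePoint a hF t
  ext i
  rw [mem_coordSupport, h]
  simp [hc]

theorem height_facePoint (a : Fin (N + 1) → Fin n → ℤ) {F : Finset (Fin (N + 1))}
    (hF : F.Nonempty) {t : Fin n → Qbarˣ} (ht : ∀ j, IsOfFinOrder (t j)) :
    height (facePoint a hF t) = 1 / 2 * Real.log F.card := by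
  obtain ⟨c, hc, h⟩ := exists_rep_facePoint a hF t
  let e := ∏ j, orderOf (t j)
  have he : e ≠ 0 := Finset.prod_ne_zero_iff.2 fun j _ => (ht j).orderOf_pos.ne'
  have hte : ∀ j, t j ^ e = 1 := fun j =>
    orderOf_dvd_iff_pow_eq_one.1 (Finset.dvd_prod_of_mem _ (Finset.mem_univ j))
  have hpow : ∀ i, (facePoint a hF t).rep i ≠ 0 → (facePoint a hF t).rep i ^ e = c ^ e := by
    intro i hi
    rw [← mem_coordSupport, coordSupport_facePoint] at hi
    have : monomial t (a i) ^ e = 1 := by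
      rw [monomial, ← Finset.prod_pow]
      refine Finset.prod_eq_one fun j _ => ?_
      rw [← zpow_natCast, zpow_comm, zpow_natCast, hte, one_zpow]
    rw [h, if_pos hi, mul_pow, ← Units.val_pow_eq_pow_val, this, Units.val_one, mul_one]
  obtain ⟨k, hk⟩ := coordSupport_nonempty (facePoint a hF t)
  rw [mem_coordSupport] at hk
  rw [height_eq_half_log_card hk he fun i hi => (hpow i hi).trans (hpow k hk).symm,
    coordSupport_facePoint]

/-- The orbit of a face lies in the toric variety. Let `f` be a form of degree `d` that vanishes on
the image of the torus. Its monomials `x ^ u` with support in the face are those for which the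
functional defining the face takes its maximum at `∑ u_i a_i`, so that they make up entire fibres of
`u ↦ ∑ u_i a_i`, and the coefficients of `f` add up to zero on each fibre. -/
theorem facePoint_mem_toricVariety {a : Fin (N + 1) → Fin n → ℤ} {F : Finset (Fin (N + 1))}
    (hF : IsIndexFace a F) (t : Fin n → Qbarˣ) : facePoint a hF.1 t ∈ toricVariety a := by
  classical
  obtain ⟨S, hS, hSeq⟩ := isClosed_iff_isAlgebraicSet.1 (isClosed_toricVariety a)
  rw [hSeq]
  intro f hf
  obtain ⟨d, hd⟩ := hS f hf
  obtain ⟨l, m, hle, hmem⟩ := hF.2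
  rw [facePoint, eval_rep_mk hd]
  have hvan : ∀ t : Fin n → Qbarˣ, MvPolynomial.eval (fun i => (monomial t (a i) : Qbar)) f = 0 := by
    intro t
    have : monomialMap a t ∈ toricVariety a := subset_closure ⟨t, rfl⟩
    rw [hSeq] at this
    exact (eval_rep_mk hd _).1 (this f hf)
  have hprod : ∀ (t : Fin n → Qbarˣ) (u : Fin (N + 1) →₀ ℕ),
      ∏ i, (monomial t (a i) : Qbar) ^ u i = (monomial t (∑ i, u i • a i) : Qbarˣ) := by
    intro t u
    rw [← prod_monomial_pow]
    simp
  -- The test function is `t ^ w` at the exponents `w` where `l` takes the value `d * m`, its maximum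
  -- in degree `d`, and zero at the others.
  have key := sum_mul_comp_eq_zero f.support (fun u => MvPolynomial.coeff u f)
    (fun u => ∑ i, u i • a i) (fun t => by
      rw [← hvan t, MvPolynomial.eval_eq']
      simp only [hprod])
    (fun w => if l (fun j => (w j : ℝ)) = d * m then (monomial t w : Qbar) else 0)
  refine Eq.trans ?_ key
  rw [MvPolynomial.eval_eq']
  refine Finset.sum_congr rfl fun u hu => ?_
  congr 1
  have hdeg : ∑ i, (u i : ℝ) = d := by
    have h := hd (MvPolynomial.mem_support_iff.1 hu)
    rw [Finsupp.weight_apply, Finsupp.sum_fintype _ _ (by simp)] at h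
    rw [← h]
    simp
  have hl : l (fun j => (((∑ i, u i • a i) j : ℤ) : ℝ)) = ∑ i, (u i : ℝ) * l (realPoint a i) := by
    have : (fun j => (((∑ i, u i • a i) j : ℤ) : ℝ)) = ∑ i, (u i : ℝ) • realPoint a i := by
      ext j
      simp [realPoint]
    rw [this, map_sum]
    simp
  simp only [hl]
  have hiff : ∑ i, (u i : ℝ) * l (realPoint a i) = d * m ↔ ∀ i, u i ≠ 0 → i ∈ F := by
    rw [← hdeg, Finset.sum_mul, Finset.sum_eq_sum_iff_of_le
      fun i _ => mul_le_mul_of_nonneg_left (hle i) (Nat.cast_nonneg _)]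
    refine forall_congr' fun i => ?_
    rw [hmem]
    simp only [Finset.mem_univ, true_imp_iff, mul_eq_mul_left_iff, Nat.cast_eq_zero]
    tauto
  by_cases hu' : ∀ i, u i ≠ 0 → i ∈ F
  · rw [if_pos (hiff.2 hu'), ← hprod]
    refine Finset.prod_congr rfl fun i _ => ?_
    by_cases hi : u i = 0
    · simp [hi]
    · rw [if_pos (hu' i hi)]
  · rw [if_neg (mt hiff.1 hu')]
    push Not at hu'
    obtain ⟨i, hi, hi'⟩ := hu'
    exact Finset.prod_eq_zero (Finset.mem_univ i) (by rw [if_neg hi', zero_pow hi])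

/-! ### The closure of the torsion points of an orbit -/

/-- A subset of projective space that is parametrized by polynomials, with parameters running over
a power of an infinite set, is irreducible. -/
theorem isIrreducible_range_of_polynomial {j : ℕ} {ι : Type*} [Infinite ι] {q : ι → Qbar}
    (hq : Function.Injective q) (p : Fin (N + 1) → MvPolynomial (Fin j) Qbar)
    (φ : (Fin j → ι) → ProjSpace N) (hφ : ∀ ζ, ∃ c : Qbar, c ≠ 0 ∧
      (φ ζ).rep = c • fun i => MvPolynomial.eval (fun m => q (ζ m)) (p i)) :
    IsIrreducible (Set.range φ) := by
  have heval : ∀ {f : MvPolynomial (Fin (N + 1)) Qbar} {d : ℕ}, f.IsHomogeneous d → ∀ ζ,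
      (MvPolynomial.eval (φ ζ).rep f ≠ 0 ↔
        MvPolynomial.eval (fun m => q (ζ m)) (MvPolynomial.aeval p f) ≠ 0) := by
    intro f d hf ζ
    obtain ⟨c, hc, h⟩ := hφ ζ
    rw [h, eval_smul_of_isHomogeneous hf, mul_ne_zero_iff, and_iff_right (pow_ne_zero _ hc)]
    have : MvPolynomial.eval (fun m => q (ζ m)) (MvPolynomial.aeval p f) =
        MvPolynomial.eval (fun i => MvPolynomial.eval (fun m => q (ζ m)) (p i)) f := by
      rw [MvPolynomial.aeval_def, MvPolynomial.algebraMap_eq, ← MvPolynomial.eval_assoc]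
      rfl
    rw [this]
  have hopen : ∀ {u : Set (ProjSpace N)}, IsOpen u → ∀ ζ, φ ζ ∈ u →
      ∃ f : MvPolynomial (Fin (N + 1)) Qbar, MvPolynomial.eval (fun m => q (ζ m))
        (MvPolynomial.aeval p f) ≠ 0 ∧ ∀ ζ', MvPolynomial.eval (fun m => q (ζ' m))
        (MvPolynomial.aeval p f) ≠ 0 → φ ζ' ∈ u := by
    intro u hu ζ hζ
    obtain ⟨S, hS, hSeq⟩ := isClosed_iff_isAlgebraicSet.1 hu.isClosed_compl
    have : φ ζ ∉ zeroLocus S := by rw [← hSeq]; simpa using hζ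
    simp only [zeroLocus, Set.mem_ofPred_eq, not_forall] at this
    obtain ⟨f, hf, hf0⟩ := this
    obtain ⟨d, hd⟩ := hS f hf
    refine ⟨f, (heval hd ζ).1 hf0, fun ζ' hζ' => ?_⟩
    by_contra hcon
    have hmem : φ ζ' ∈ zeroLocus S := by rw [← hSeq]; exact hcon
    exact (heval hd ζ').2 hζ' (hmem f hf)
  refine ⟨Set.range_nonempty φ, ?_⟩
  rintro u v hu hv ⟨_, ⟨ζ, rfl⟩, hζ⟩ ⟨_, ⟨ζ', rfl⟩, hζ'⟩
  obtain ⟨f, hf, hfu⟩ := hopen hu ζ hζ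
  obtain ⟨g, hg, hgv⟩ := hopen hv ζ' hζ'
  -- A nonzero polynomial cannot vanish on a power of an infinite set.
  have hfg : MvPolynomial.aeval p f * MvPolynomial.aeval p g ≠ 0 :=
    mul_ne_zero (fun h => hf (by rw [h, map_zero])) (fun h => hg (by rw [h, map_zero]))
  have hex : ∃ ξ : Fin j → ι, MvPolynomial.eval (fun m => q (ξ m))
      (MvPolynomial.aeval p f * MvPolynomial.aeval p g) ≠ 0 := by
    by_contra! hcon
    refine hfg (MvPolynomial.funext_set (fun _ => Set.range q)
      (fun _ => Set.infinite_range_of_injective hq) fun x hx => ?_)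
    have hx' : ∀ m, ∃ y, q y = x m := fun m => hx m (Set.mem_univ m)
    choose y hy using hx'
    rw [map_zero, ← hcon y]
    simp only [hy]
  obtain ⟨ξ, hξ⟩ := hex
  rw [map_mul, mul_ne_zero_iff] at hξ
  exact ⟨φ ξ, ⟨ξ, rfl⟩, hfu ξ hξ.1, hgv ξ hξ.2⟩

theorem exists_torsion_orderOf_eq {d : ℕ} (hd : d ≠ 0) :
    ∃ ω : CommGroup.torsion Qbarˣ, orderOf ω = d := by
  have : NeZero (d : Qbar) := ⟨by exact_mod_cast hd⟩
  have : NeZero d := ⟨hd⟩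
  obtain ⟨ω, hω⟩ := HasEnoughRootsOfUnity.exists_primitiveRoot Qbar d
  have hu := hω.isUnit hd
  have hω' : IsPrimitiveRoot hu.unit d := IsPrimitiveRoot.coe_units_iff.1 (by simpa using hω)
  refine ⟨⟨hu.unit, ?_⟩, ?_⟩
  · exact isOfFinOrder_iff_pow_eq_one.2 ⟨d, Nat.pos_of_ne_zero hd, hω'.pow_eq_one⟩
  · rw [← Subgroup.orderOf_coe]
    exact hω'.eq_orderOf.symm

instance : Infinite (CommGroup.torsion Qbarˣ) := by
  choose f hf using fun d : ℕ => exists_torsion_orderOf_eq (Nat.succ_ne_zero d)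
  refine Infinite.of_injective f fun d e h => ?_
  have := congrArg orderOf h
  rw [hf, hf] at this
  omega

/-- The image of a point under the homomorphism of tori given by an integral matrix. -/
def torusPoint {j : ℕ} (L : Fin j → Fin n → ℤ) (z : Fin j → Qbarˣ) : Fin n → Qbarˣ :=
  fun b => ∏ m, z m ^ L m b

theorem monomial_torusPoint {j : ℕ} (L : Fin j → Fin n → ℤ) (z : Fin j → Qbarˣ) (c : Fin n → ℤ) :
    monomial (torusPoint L z) c = ∏ m, z m ^ ∑ b, L m b * c b := by
  simp only [monomial, torusPoint, ← Finset.prod_zpow, ← zpow_mul]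
  rw [Finset.prod_comm]
  refine Finset.prod_congr rfl fun m _ => ?_
  exact (map_sum (zpowersHom Qbarˣ (z m)).toAdditive _ _).symm

/-- Among the vectors `a_i` of a set of affine dimension `j` there are `j + 1` that an integral
linear map sends, up to translation, to the vertices of a multiple of the standard simplex. -/
theorem exists_integral_coordinates (a : Fin (N + 1) → Fin n → ℤ) {F : Finset (Fin (N + 1))}
    (hF : F.Nonempty) : ∃ i₀ ∈ F, ∃ i : Fin (affineDim a F) → Fin (N + 1), (∀ m, i m ∈ F) ∧
      ∃ (L : Fin (affineDim a F) → Fin n → ℤ) (d : ℤ), d ≠ 0 ∧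
        ∀ m k, ∑ b, L m b * a (i k) b - ∑ b, L m b * a i₀ b = if m = k then d else 0 := by
  classical
  obtain ⟨i₀, hi₀⟩ := hF
  have hspan := vectorSpan_eq_span_vsub_set_right ℝ
    (show realPoint a i₀ ∈ realPoint a '' F from ⟨i₀, hi₀, rfl⟩)
  obtain ⟨B, hBsub, hBspan, hBli⟩ := exists_linearIndependent ℝ
    ((· -ᵥ realPoint a i₀) '' (realPoint a '' F))
  have hBfin : B.Finite := ((F.finite_toSet.image _).image _).subset hBsub
  have := hBfin.fintype
  have hcard : Fintype.card B = affineDim a F := by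
    rw [affineDim, hspan, ← hBspan, finrank_span_set_eq_card hBli, Set.toFinset_card]
  let e : Fin (affineDim a F) ≃ B := (Fintype.equivFinOfCardEq hcard).symm
  have hex : ∀ m, ∃ i ∈ F, realPoint a i - realPoint a i₀ = e m := by
    intro m
    obtain ⟨_, ⟨i, hi, rfl⟩, h⟩ := hBsub (e m).2
    exact ⟨i, hi, h⟩
  choose i hiF hi using hex
  let v : Fin (affineDim a F) → Fin n → ℚ := fun m b => (a (i m) b : ℚ) - a i₀ b
  have hv : LinearIndependent ℚ v := by
    rw [← linearIndependent_algebraMap_comp_iff (S := ℝ)]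
    have heq : (fun m => algebraMap ℚ ℝ ∘ v m) = fun m => (e m : Fin n → ℝ) := by
      funext m
      rw [← hi]
      ext b
      simp [v, realPoint]
    rw [heq]
    exact hBli.comp e e.injective
  have hker : LinearMap.ker (Fintype.linearCombination ℚ v) = ⊥ :=
    LinearMap.ker_eq_bot.2 (linearIndependent_iff_injective_fintypeLinearCombination.1 hv)
  obtain ⟨g, hg⟩ := LinearMap.exists_leftInverse_of_injective _ hker
  obtain ⟨d, hd⟩ := IsLocalization.exist_integer_multiples_of_finite (nonZeroDivisors ℤ)
    (fun p : Fin (affineDim a F) × Fin n => g (Pi.single p.2 1) p.1)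
  choose L hL using hd
  refine ⟨i₀, hi₀, i, hiF, fun m b => L (m, b), d, nonZeroDivisors.coe_ne_zero d, fun m k => ?_⟩
  -- Clearing the denominators of a left inverse of the matrix `v` gives `L`.
  have hgv : g (v k) = Pi.single k 1 := by
    have := LinearMap.congr_fun hg (Pi.single k 1)
    simpa using this
  have hsum : g (v k) m = ∑ b, v k b * g (Pi.single b 1) m := by
    rw [LinearMap.pi_apply_eq_sum_univ g (v k), Finset.sum_apply]
    refine Finset.sum_congr rfl fun b _ => ?_
    have : (fun b' => if b = b' then (1 : ℚ) else 0) = Pi.single b 1 := by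
      ext b'
      simp [Pi.single_apply, eq_comm]
    rw [this]
    rfl
  have hQ : ((∑ b, L (m, b) * a (i k) b - ∑ b, L (m, b) * a i₀ b : ℤ) : ℚ) =
      ((if m = k then (d : ℤ) else 0 : ℤ) : ℚ) := by
    have h1 : ∀ b, (L (m, b) : ℚ) = (d : ℤ) * g (Pi.single b 1) m := fun b => by
      have := hL (m, b)
      simpa using this
    rw [← Finset.sum_sub_distrib]
    push_cast
    simp only [h1]
    have : ∀ b, ((d : ℤ) : ℚ) * g (Pi.single b 1) m * a (i k) b -
        (d : ℤ) * g (Pi.single b 1) m * a i₀ b = (d : ℤ) * (v k b * g (Pi.single b 1) m) :=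
      fun b => by simp only [v]; ring
    rw [Finset.sum_congr rfl fun b _ => this b, ← Finset.mul_sum, ← hsum, hgv, Pi.single_apply]
    split_ifs <;> simp
  exact_mod_cast hQ

/-- A closed set that contains all torsion points of the orbit of a set of indices has at least the
dimension of this set: the torsion points of the coordinate subtori form a chain of irreducible
sets. -/
theorem affineDim_le_topologicalKrullDim (a : Fin (N + 1) → Fin n → ℤ)
    {F : Finset (Fin (N + 1))} (hF : F.Nonempty) {W : Set (ProjSpace N)} (hW : IsClosed W)
    (hFW : ∀ t : Fin n → Qbarˣ, (∀ b, IsOfFinOrder (t b)) → facePoint a hF t ∈ W) :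
    (affineDim a F : ℕ∞) ≤ topologicalKrullDim W := by
  classical
  obtain ⟨i₀, hi₀, i, hi, L, d, hd, hL⟩ := exists_integral_coordinates a hF
  -- The subtori are given by setting the parameters from the index `k` on equal to one.
  let trunc : ℕ → (Fin (affineDim a F) → CommGroup.torsion Qbarˣ) →
    (Fin (affineDim a F) → CommGroup.torsion Qbarˣ) := fun k ζ m => if (m : ℕ) < k then ζ m else 1
  let φ : ℕ → (Fin (affineDim a F) → CommGroup.torsion Qbarˣ) → ProjSpace N := fun k ζ =>
    facePoint a hF (torusPoint L fun m => (trunc k ζ m : Qbarˣ))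
  -- The exponents of the parametrization become nonnegative when `M` is added to all of them, which
  -- amounts to multiplying all coordinates by the same factor.
  let E : Fin (N + 1) → Fin (affineDim a F) → ℤ := fun i m => ∑ b, L m b * a i b
  let M : ℕ := ∑ i, ∑ m, (E i m).natAbs
  have hM : ∀ i m, 0 ≤ E i m + M := by
    intro i m
    have h1 : (E i m).natAbs ≤ ∑ m, (E i m).natAbs :=
      Finset.single_le_sum (f := fun m => (E i m).natAbs) (fun _ _ => Nat.zero_le _)
        (Finset.mem_univ m)
    have h2 : ∑ m, (E i m).natAbs ≤ M :=
      Finset.single_le_sum (f := fun i => ∑ m, (E i m).natAbs) (fun _ _ => Nat.zero_le _)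
        (Finset.mem_univ i)
    omega
  refine natCast_le_topologicalKrullDim hW (fun k => Set.range (φ k)) (fun k => ?_) (fun k => ?_) ?_
  · refine isIrreducible_range_of_polynomial
      (q := fun z : CommGroup.torsion Qbarˣ => ((z : Qbarˣ) : Qbar))
      (fun z w h => Subtype.ext (Units.ext h))
      (fun i => if i ∈ F then
        ∏ m : Fin (affineDim a F), (if (m : ℕ) < k then MvPolynomial.X m else 1) ^
          (E i m + M).toNat else 0) _ fun ζ => ?_
    obtain ⟨c, hc, h⟩ := exists_rep_facePoint a hF
      (torusPoint L fun m => (trunc k ζ m : Qbarˣ))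
    refine ⟨c * (((∏ m, (trunc k ζ m : Qbarˣ) ^ M)⁻¹ : Qbarˣ) : Qbar),
      mul_ne_zero hc (Units.ne_zero _), ?_⟩
    funext i
    rw [h, Pi.smul_apply, smul_eq_mul, mul_assoc]
    congr 1
    split_ifs with hiF
    · have hpow : ∀ m : Fin (affineDim a F), (MvPolynomial.eval
          (fun m => ((ζ m : Qbarˣ) : Qbar)) (if (m : ℕ) < k then MvPolynomial.X m else 1)) =
          ((trunc k ζ m : Qbarˣ) : Qbar) := fun m => by
        simp only [trunc]
        split_ifs <;> simp
      simp only [map_prod, map_pow, hpow]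
      rw [monomial_torusPoint]
      have hshift : ∏ m, (trunc k ζ m : Qbarˣ) ^ E i m = (∏ m, (trunc k ζ m : Qbarˣ) ^ M)⁻¹ *
          ∏ m, (trunc k ζ m : Qbarˣ) ^ (E i m + M).toNat := by
        rw [eq_inv_mul_iff_mul_eq, ← Finset.prod_mul_distrib]
        refine Finset.prod_congr rfl fun m _ => ?_
        rw [← zpow_natCast, ← zpow_natCast, ← zpow_add, Int.toNat_of_nonneg (hM i m), add_comm]
      rw [hshift]
      simp
    · simp
  · rintro _ ⟨ζ, rfl⟩
    refine hFW _ fun b => ?_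
    exact (CommGroup.mem_torsion _).1 (Subgroup.prod_mem _ fun m _ =>
      Subgroup.zpow_mem _ (trunc k ζ m).2 _)
  · intro k hk
    let k' : Fin (affineDim a F) := ⟨k, hk⟩
    have htr : ∀ ζ, trunc (k + 1) (trunc k ζ) = trunc k ζ := by
      intro ζ
      funext m
      simp only [trunc]
      split_ifs <;> first | rfl | omega
    have hquot : ∀ z : Fin (affineDim a F) → Qbarˣ, monomial (torusPoint L z) (a (i k')) =
        monomial (torusPoint L z) (a i₀) * z k' ^ d := by
      intro z
      rw [monomial_torusPoint, monomial_torusPoint]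
      have h1 : ∀ m, ∑ b, L m b * a (i k') b = ∑ b, L m b * a i₀ b + if m = k' then d else 0 :=
        fun m => by rw [← hL m k']; ring
      simp only [h1, zpow_add, Finset.prod_mul_distrib]
      congr 1
      rw [Finset.prod_eq_single k'] <;> simp +contextual
    -- The coordinates of the indices `i k` and `i₀` agree on the `k`-th set, but not on the next.
    have hmem : ∀ ζ, MvPolynomial.eval (φ k ζ).rep
        (MvPolynomial.X (i k') - MvPolynomial.X i₀) = 0 := by
      intro ζ
      obtain ⟨c, hc, h⟩ := exists_rep_facePoint a hF (torusPoint L fun m => (trunc k ζ m : Qbarˣ))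
      have h1 : trunc k ζ k' = 1 := by simp [trunc, k']
      simp only [φ, map_sub, MvPolynomial.eval_X, h, if_pos hi₀, if_pos (hi k'), hquot, h1]
      simp
    have hom : (MvPolynomial.X (i k') - MvPolynomial.X i₀ :
        MvPolynomial (Fin (N + 1)) Qbar).IsHomogeneous 1 :=
      (MvPolynomial.isHomogeneous_X _ _).sub (MvPolynomial.isHomogeneous_X _ _)
    refine ⟨closure_mono ?_, fun hsub => ?_⟩
    · rintro _ ⟨ζ, rfl⟩
      refine ⟨trunc k ζ, ?_⟩
      simp only [φ, htr]
    · obtain ⟨ω, hω⟩ := exists_torsion_orderOf_eq (d := d.natAbs + 1) (by omega)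
      have := eval_eq_zero_of_mem_closure hom (by rintro _ ⟨ζ, rfl⟩; exact hmem ζ)
        (hsub (subset_closure ⟨fun _ => ω, rfl⟩))
      obtain ⟨c, hc, h⟩ := exists_rep_facePoint a hF
        (torusPoint L fun m => (trunc (k + 1) (fun _ => ω) m : Qbarˣ))
      have h1 : trunc (k + 1) (fun _ => ω) k' = ω := by simp [trunc, k']
      simp only [φ, map_sub, MvPolynomial.eval_X, h, if_pos hi₀, if_pos (hi k'), hquot, h1] at this
      rw [Units.val_mul, ← mul_sub, ← mul_sub_one, mul_eq_zero, mul_eq_zero, or_iff_right hc,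
        or_iff_right (Units.ne_zero _), sub_eq_zero, ← Units.val_one, Units.val_inj] at this
      have hdvd := orderOf_dvd_iff_zpow_eq_one.2 this
      rw [Subgroup.orderOf_coe, hω] at hdvd
      have := Nat.le_of_dvd (Int.natAbs_pos.2 hd) (Int.natCast_dvd.1 hdvd)
      omega

/-! ### Faces of the polytope -/

theorem le_ker_of_eq_const {a : Fin (N + 1) → Fin n → ℤ} {S : Set (Fin (N + 1))}
    {l : (Fin n → ℝ) →ₗ[ℝ] ℝ} {m : ℝ} (h : ∀ i ∈ S, l (realPoint a i) = m) :
    vectorSpan ℝ (realPoint a '' S) ≤ LinearMap.ker l := by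
  refine Submodule.span_le.2 ?_
  rintro _ ⟨_, ⟨i, hi, rfl⟩, _, ⟨k, hk, rfl⟩, rfl⟩
  simp [h i hi, h k hk]

theorem eq_of_le_ker {a : Fin (N + 1) → Fin n → ℤ} {S : Set (Fin (N + 1))}
    {l : (Fin n → ℝ) →ₗ[ℝ] ℝ} (h : vectorSpan ℝ (realPoint a '' S) ≤ LinearMap.ker l)
    {i k : Fin (N + 1)} (hi : i ∈ S) (hk : k ∈ S) : l (realPoint a i) = l (realPoint a k) := by
  have := h (vsub_mem_vectorSpan ℝ (Set.mem_image_of_mem _ hi) (Set.mem_image_of_mem _ hk))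
  simpa [sub_eq_zero] using this

/-- A face of a face is a face: add a large multiple of the functional of the larger face. -/
theorem IsIndexFace.of_subface {a : Fin (N + 1) → Fin n → ℤ} {F G : Finset (Fin (N + 1))}
    (hF : IsIndexFace a F) (hG : G.Nonempty) (hGF : G ⊆ F) (l : (Fin n → ℝ) →ₗ[ℝ] ℝ) (m : ℝ)
    (hle : ∀ i ∈ F, l (realPoint a i) ≤ m) (hiff : ∀ i ∈ F, i ∈ G ↔ l (realPoint a i) = m) :
    IsIndexFace a G := by
  obtain ⟨l₀, m₀, hle₀, hiff₀⟩ := hF.2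
  have hlt : ∀ i, i ∉ F → 0 < m₀ - l₀ (realPoint a i) := fun i hi =>
    sub_pos.2 (lt_of_le_of_ne (hle₀ i) (mt (hiff₀ i).2 hi))
  have hev : ∀ i, ∀ᶠ K : ℝ in Filter.atTop,
      i ∉ F → l (realPoint a i) - m < K * (m₀ - l₀ (realPoint a i)) := by
    intro i
    by_cases hi : i ∈ F
    · simp [hi]
    · filter_upwards [(Filter.tendsto_id.atTop_mul_const (hlt i hi)).eventually_gt_atTop
        (l (realPoint a i) - m)] with K hK _
      exact hK
  obtain ⟨K, hK⟩ := (Filter.eventually_all.2 hev).exists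
  have key : ∀ i, l (realPoint a i) + K * l₀ (realPoint a i) ≤ m + K * m₀ ∧
      (i ∈ G ↔ l (realPoint a i) + K * l₀ (realPoint a i) = m + K * m₀) := by
    intro i
    by_cases hi : i ∈ F
    · rw [(hiff₀ i).1 hi, add_le_add_iff_right, add_left_inj]
      exact ⟨hle i hi, hiff i hi⟩
    · have := hK i hi
      have hne : l (realPoint a i) + K * l₀ (realPoint a i) < m + K * m₀ := by linarith
      exact ⟨hne.le, ⟨fun h => absurd (hGF h) hi, fun h => absurd h hne.ne⟩⟩
  exact ⟨hG, l + K • l₀, m + K * m₀, fun i => by simpa using (key i).1,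
    fun i => by simpa using (key i).2⟩

theorem isIndexFace_univ (a : Fin (N + 1) → Fin n → ℤ) : IsIndexFace a Finset.univ :=
  ⟨Finset.univ_nonempty, 0, 0, by simp, by simp⟩

open Classical in
/-- The vectors of a face on which a linear functional is maximal form a face. -/
theorem IsIndexFace.exists_argmax {a : Fin (N + 1) → Fin n → ℤ} {F : Finset (Fin (N + 1))}
    (hF : IsIndexFace a F) (l : (Fin n → ℝ) →ₗ[ℝ] ℝ) :
    ∃ k ∈ F, (∀ i ∈ F, l (realPoint a i) ≤ l (realPoint a k)) ∧
      IsIndexFace a (F.filter fun i => l (realPoint a i) = l (realPoint a k)) := by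
  obtain ⟨k, hk, hmax⟩ := F.exists_max_image (fun i => l (realPoint a i)) hF.1
  exact ⟨k, hk, hmax, hF.of_subface ⟨k, by simp [hk]⟩ (Finset.filter_subset _ _) l _ hmax
    fun i hi => by simp [hi]⟩

/-- Every face of positive dimension has a facet. A maximal proper subface `G` is one: otherwise
some functional, not proportional to that of `G`, is constant on `G` as well, and the functional of
`G` can be tilted in its direction until the maximum is attained at a further vector. -/
theorem IsIndexFace.exists_facet {a : Fin (N + 1) → Fin n → ℤ} {F : Finset (Fin (N + 1))}
    (hF : IsIndexFace a F) (hpos : 0 < affineDim a F) :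
    ∃ G ⊆ F, IsIndexFace a G ∧ affineDim a G + 1 = affineDim a F := by
  classical
  let V := vectorSpan ℝ (realPoint a '' (F : Set (Fin (N + 1))))
  have hproper : ((F.powerset.filter fun G => IsIndexFace a G ∧ G ≠ F)).Nonempty := by
    obtain ⟨v, hvV, hv⟩ := V.exists_mem_ne_zero_of_ne_bot (by
      intro h
      rw [affineDim, show vectorSpan ℝ (realPoint a '' (F : Set (Fin (N + 1)))) = ⊥ from h,
        finrank_bot] at hpos
      exact hpos.false)
    obtain ⟨l, hl, -⟩ := Submodule.exists_le_ker_of_notMem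
      (p := (⊥ : Submodule ℝ (Fin n → ℝ))) (v := v) (by simpa using hv)
    obtain ⟨k, hk, -, hface⟩ := hF.exists_argmax l
    refine ⟨_, Finset.mem_filter.2 ⟨Finset.mem_powerset.2 (Finset.filter_subset _ _), hface, ?_⟩⟩
    intro heq
    refine hl (le_ker_of_eq_const (a := a) (S := F) (m := l (realPoint a k)) (fun i hi => ?_) hvV)
    rw [Finset.mem_coe, ← heq] at hi
    exact (Finset.mem_filter.1 hi).2
  obtain ⟨G, hG, hmax⟩ := Finset.exists_max_image _ Finset.card hproper
  rw [Finset.mem_filter, Finset.mem_powerset] at hG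
  obtain ⟨hGF, hGface, hGne⟩ := hG
  refine ⟨G, hGF, hGface, ?_⟩
  obtain ⟨⟨k, hk⟩, l, m, hle, hiff⟩ := hGface
  let U := vectorSpan ℝ (realPoint a '' (G : Set (Fin (N + 1))))
  have hUV : U ≤ V ⊓ LinearMap.ker l :=
    le_inf (vectorSpan_mono ℝ (Set.image_mono hGF)) (le_ker_of_eq_const fun i hi => (hiff i).1 hi)
  have hlV : ¬ V ≤ LinearMap.ker l := by
    intro h
    refine hGne (hGF.antisymm fun i hi => ?_)
    rw [hiff, eq_of_le_ker h hi (hGF hk), ← hiff]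
    exact hk
  have hdim : Module.finrank ℝ V ≤ Module.finrank ℝ ↥(V ⊓ LinearMap.ker l) + 1 := by
    have h1 := Submodule.finrank_sup_add_finrank_inf_eq V (LinearMap.ker l)
    have h2 := LinearMap.finrank_range_add_finrank_ker l
    have h3 := Submodule.finrank_le (V ⊔ LinearMap.ker l)
    have h4 := Submodule.finrank_le (LinearMap.range l)
    rw [Module.finrank_self] at h4
    omega
  have hlt : Module.finrank ℝ U < Module.finrank ℝ V :=
    Submodule.finrank_lt_finrank_of_lt (lt_of_le_of_ne (hUV.trans inf_le_left) fun h =>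
      hlV (h ▸ hUV.trans inf_le_right))
  by_contra hne
  have hlt' : Module.finrank ℝ U < Module.finrank ℝ ↥(V ⊓ LinearMap.ker l) := by
    change Module.finrank ℝ U + 1 ≠ Module.finrank ℝ V at hne
    omega
  obtain ⟨v, hv, hvU⟩ : ∃ v ∈ V ⊓ LinearMap.ker l, v ∉ U := by
    by_contra! hcon
    exact hlt'.not_ge (Submodule.finrank_mono hcon)
  -- The functional `l₁` is constant on `G`, but not proportional to `l` on the span of `F`.
  obtain ⟨l₁, hl₁v, hl₁U⟩ := Submodule.exists_le_ker_of_notMem hvU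
  have htilt : ∃ l' : (Fin n → ℝ) →ₗ[ℝ] ℝ, l' v ≠ 0 ∧ U ≤ LinearMap.ker l' ∧
      ∃ i ∈ F, l' (realPoint a k) < l' (realPoint a i) := by
    have : ∃ i ∈ F, l₁ (realPoint a i) ≠ l₁ (realPoint a k) := by
      by_contra! hcon
      exact hl₁v (le_ker_of_eq_const (a := a) (S := F) hcon hv.1)
    obtain ⟨i, hi, hik⟩ := this
    rcases lt_or_gt_of_ne hik with h | h
    · exact ⟨-l₁, by simpa using hl₁v, fun x hx => by simpa using hl₁U hx, i, hi, by simpa using h⟩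
    · exact ⟨l₁, hl₁v, hl₁U, i, hi, h⟩
  obtain ⟨l', hl'v, hl'U, hl'F⟩ := htilt
  obtain ⟨i, hi, hmin⟩ := Finset.exists_min_image
    (F.filter fun i => l' (realPoint a k) < l' (realPoint a i))
    (fun i => (m - l (realPoint a i)) / (l' (realPoint a i) - l' (realPoint a k)))
    (by obtain ⟨i, hi, h⟩ := hl'F; exact ⟨i, by simp [hi, h]⟩)
  rw [Finset.mem_filter] at hi
  -- The least tilt at which a further vector attains the maximum.
  set s := (m - l (realPoint a i)) / (l' (realPoint a i) - l' (realPoint a k)) with hs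
  have hGk : ∀ b ∈ G, l' (realPoint a b) = l' (realPoint a k) := fun b hb => eq_of_le_ker hl'U hb hk
  have hiG : i ∉ G := fun h => hi.2.ne' (hGk i h)
  have hs0 : 0 < s := div_pos (sub_pos.2 (lt_of_le_of_ne (hle i) (mt (hiff i).2 hiG)))
    (sub_pos.2 hi.2)
  have hbound : ∀ b ∈ F, (l + s • l') (realPoint a b) ≤ m + s * l' (realPoint a k) := by
    intro b hb
    simp only [LinearMap.add_apply, LinearMap.smul_apply, smul_eq_mul]
    rcases le_or_gt (l' (realPoint a b)) (l' (realPoint a k)) with h | h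
    · have := mul_le_mul_of_nonneg_left h hs0.le
      linarith [hle b]
    · have := hmin b (Finset.mem_filter.2 ⟨hb, h⟩)
      rw [le_div_iff₀ (sub_pos.2 h)] at this
      linarith
  let G' := F.filter fun b => (l + s • l') (realPoint a b) = m + s * l' (realPoint a k)
  have hGG' : G ⊆ G' := fun b hb => Finset.mem_filter.2 ⟨hGF hb, by
    simp [(hiff b).1 hb, hGk b hb]⟩
  have hiG' : i ∈ G' := Finset.mem_filter.2 ⟨hi.1, by
    have : s * (l' (realPoint a i) - l' (realPoint a k)) = m - l (realPoint a i) :=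
      div_mul_cancel₀ _ (sub_pos.2 hi.2).ne'
    simp only [LinearMap.add_apply, LinearMap.smul_apply, smul_eq_mul]
    linarith⟩
  have hG'face : IsIndexFace a G' := hF.of_subface ⟨i, hiG'⟩ (Finset.filter_subset _ _)
    (l + s • l') _ hbound fun b hb => by simp [G', hb]
  have hG'ne : G' ≠ F := by
    intro h
    have := le_ker_of_eq_const (a := a) (S := F) (l := l + s • l')
      (m := m + s * l' (realPoint a k)) (fun b hb => by
        rw [Finset.mem_coe, ← h] at hb
        exact (Finset.mem_filter.1 hb).2) hv.1
    have hlv : l v = 0 := hv.2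
    simp only [LinearMap.mem_ker, LinearMap.add_apply, LinearMap.smul_apply, smul_eq_mul, hlv,
      zero_add, mul_eq_zero] at this
    exact this.elim hs0.ne' hl'v
  have hcard := hmax G' (Finset.mem_filter.2
    ⟨Finset.mem_powerset.2 (Finset.filter_subset _ _), hG'face, hG'ne⟩)
  exact hcard.not_gt (Finset.card_lt_card ⟨hGG', fun h => hiG (h hiG')⟩)

theorem IsIndexFace.exists_subface {a : Fin (N + 1) → Fin n → ℤ} {F : Finset (Fin (N + 1))}
    (hF : IsIndexFace a F) {j : ℕ} (hj : j ≤ affineDim a F) :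
    ∃ G ⊆ F, IsIndexFace a G ∧ affineDim a G = j := by
  induction hd : affineDim a F - j generalizing F with
  | zero => exact ⟨F, subset_rfl, hF, by omega⟩
  | succ k ih =>
    obtain ⟨G, hGF, hG, hdim⟩ := hF.exists_facet (by omega)
    obtain ⟨H, hHG, hH, hHj⟩ := ih hG (by omega) (by omega)
    exact ⟨H, hHG.trans hGF, hH, hHj⟩

/-- **Farkas' lemma** over the rational numbers. -/
theorem exists_nonneg_sum_smul_eq {V : Type*} [AddCommGroup V] [Module ℚ V] {ι : Type*}
    (s : Finset ι) (f : ι → V →ₗ[ℚ] ℚ) (g : V →ₗ[ℚ] ℚ)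
    (h : ∀ x, (∀ i ∈ s, 0 ≤ f i x) → 0 ≤ g x) :
    ∃ c : ι → ℚ, (∀ i, 0 ≤ c i) ∧ g = ∑ i ∈ s, c i • f i := by
  classical
  induction s using Finset.induction_on generalizing f g with
  | empty =>
    refine ⟨0, fun _ => le_rfl, LinearMap.ext fun x => ?_⟩
    have h1 := h x (by simp)
    have h2 := h (-x) (by simp)
    rw [map_neg] at h2
    simp only [Finset.sum_empty, LinearMap.zero_apply]
    linarith
  | insert k s hk ih =>
    by_cases hs : ∀ x, (∀ i ∈ s, 0 ≤ f i x) → 0 ≤ g x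
    · obtain ⟨c, hc, hg⟩ := ih f g hs
      refine ⟨Function.update c k 0, fun i => ?_, ?_⟩
      · by_cases hi : i = k
        · simp [hi]
        · simp [hi, hc]
      · rw [Finset.sum_insert hk, hg, Function.update_self, zero_smul, zero_add]
        refine Finset.sum_congr rfl fun i hi => ?_
        rw [Function.update_of_ne (ne_of_mem_of_not_mem hi hk)]
    · -- Project along a vector `y` that violates the conclusion onto the kernel of `f k`.
      push Not at hs
      obtain ⟨y, hy, hgy⟩ := hs
      have hfk : f k y < 0 := by
        by_contra! hcon
        refine hgy.not_ge (h y fun i hi => ?_)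
        rcases Finset.mem_insert.1 hi with rfl | hi
        exacts [hcon, hy i hi]
      set r := -(f k y)⁻¹ with hr
      have hr0 : 0 < r := by rw [hr, neg_pos, inv_lt_zero]; exact hfk
      have hrk : r * f k y = -1 := by rw [hr, neg_mul, inv_mul_cancel₀ hfk.ne]
      obtain ⟨c, hc, hg⟩ := ih (fun i => f i + (r * f i y) • f k) (g + (r * g y) • f k) (by
        intro x hx
        have := h (x + (r * f k x) • y) (fun i hi => by
          rcases Finset.mem_insert.1 hi with rfl | hi
          · simp only [map_add, map_smul, smul_eq_mul]
            linear_combination (-f i x) * hrk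
          · have := hx i hi
            simp only [LinearMap.add_apply, LinearMap.smul_apply, smul_eq_mul] at this
            simp only [map_add, map_smul, smul_eq_mul]
            linarith)
        simp only [map_add, map_smul, smul_eq_mul] at this
        simp only [LinearMap.add_apply, LinearMap.smul_apply, smul_eq_mul]
        linarith)
      refine ⟨Function.update c k (∑ i ∈ s, c i * (r * f i y) - r * g y), fun i => ?_, ?_⟩
      · by_cases hi : i = k
        · subst hi
          rw [Function.update_self]
          have h1 : 0 ≤ ∑ i ∈ s, c i * (r * f i y) :=
            Finset.sum_nonneg fun i hi => mul_nonneg (hc i) (mul_nonneg hr0.le (hy i hi))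
          have h2 : r * g y < 0 := mul_neg_of_pos_of_neg hr0 hgy
          linarith
        · simp [hi, hc]
      · rw [Finset.sum_insert hk, Function.update_self]
        have h1 : ∑ i ∈ s, Function.update c k (∑ i ∈ s, c i * (r * f i y) - r * g y) i • f i =
            ∑ i ∈ s, c i • f i := Finset.sum_congr rfl fun i hi => by
          rw [Function.update_of_ne (ne_of_mem_of_not_mem hi hk)]
        rw [h1]
        simp only [smul_add, Finset.sum_add_distrib, smul_smul, ← Finset.sum_smul] at hg
        rw [sub_smul]
        conv_lhs => rw [eq_sub_of_add_eq hg]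
        abel

/-! ### Supports of points, and faces of the polytope -/

theorem exists_natCast_eq_mul {ι : Type*} [Finite ι] (c : ι → ℚ) (hc : ∀ i, 0 ≤ c i) :
    ∃ D : ℕ, D ≠ 0 ∧ ∃ u : ι → ℕ, ∀ i, (u i : ℚ) = D * c i := by
  obtain ⟨d, hd⟩ := IsLocalization.exist_integer_multiples_of_finite (nonZeroDivisors ℤ) c
  choose L hL using hd
  refine ⟨(d : ℤ).natAbs, Int.natAbs_ne_zero.2 (nonZeroDivisors.coe_ne_zero d),
    fun i => (L i).natAbs, fun i => ?_⟩
  have h : (L i : ℚ) = (d : ℤ) * c i := by simpa using hL i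
  rw [Nat.cast_natAbs, Nat.cast_natAbs, Int.cast_abs, Int.cast_abs, h, abs_mul, abs_of_nonneg (hc i)]

/-- The support of a point of the toric variety is a face. By Farkas' lemma, an index `k` outside
the support `S` is separated from `S` by a functional unless some affine relation expresses a
combination of the vectors of `S` by vectors that include `a_k`; the binomial equation of such a
relation would force the coordinate of index `k` to be nonzero. The sum of the functionals for all
`k` defines `S`. -/
theorem isIndexFace_coordSupport {a : Fin (N + 1) → Fin n → ℤ} {ξ : ProjSpace N}
    (hξ : ξ ∈ toricVariety a) : IsIndexFace a (coordSupport ξ) := by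
  classical
  set S := coordSupport ξ with hS
  -- An affine function with rational coefficients is given by its constant and its linear part, and
  -- `b i` is the evaluation of affine functions at `a_i`.
  let b : Fin (N + 1) → (ℚ × (Fin n → ℚ)) →ₗ[ℚ] ℚ := fun i =>
    LinearMap.fst ℚ ℚ (Fin n → ℚ) + ∑ j, (a i j : ℚ) •
      (LinearMap.proj j ∘ₗ LinearMap.snd ℚ ℚ (Fin n → ℚ))
  have hb : ∀ i x, b i x = x.1 + ∑ j, (a i j : ℚ) * x.2 j := fun i x => by
    simp [b]
  have hsep : ∀ k, k ∉ S → ∃ x, (∀ i, 0 ≤ b i x) ∧ (∀ i ∈ S, b i x = 0) ∧ 0 < b k x := by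
    intro k hk
    by_contra! hcon
    obtain ⟨c, hc, hck⟩ := exists_nonneg_sum_smul_eq (Finset.univ : Finset (Fin (N + 1) ⊕ S))
      (Sum.elim b fun i => -b i) (-b k) (by
        intro x hx
        have h1 : ∀ i, 0 ≤ b i x := fun i => hx (Sum.inl i) (Finset.mem_univ _)
        have h2 : ∀ i ∈ S, b i x ≤ 0 := fun i hi => by
          simpa using hx (Sum.inr ⟨i, hi⟩) (Finset.mem_univ _)
        have := hcon x h1 fun i hi => le_antisymm (h2 i hi) (h1 i)
        simpa using this)
    obtain ⟨D, hD, u, hu⟩ := exists_natCast_eq_mul c hc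
    let p : Fin (N + 1) → ℕ := fun i => u (Sum.inl i) + if i = k then D else 0
    let q : Fin (N + 1) → ℕ := fun i => if hi : i ∈ S then u (Sum.inr ⟨i, hi⟩) else 0
    have hpq : ∀ x, ∑ i, (p i : ℚ) * b i x = ∑ i, (q i : ℚ) * b i x := by
      intro x
      have h1 := LinearMap.congr_fun hck x
      simp only [Fintype.sum_sum_type, LinearMap.add_apply, LinearMap.neg_apply, Sum.elim_inl,
        Sum.elim_inr, LinearMap.coe_sum, Finset.sum_apply, LinearMap.smul_apply, smul_eq_mul,
        mul_neg, Finset.sum_neg_distrib] at h1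
      have h2 : ∑ i, (p i : ℚ) * b i x = D * ∑ i, c (Sum.inl i) * b i x + D * b k x := by
        simp only [p, Nat.cast_add, hu, add_mul, Finset.sum_add_distrib, Finset.mul_sum, mul_assoc]
        congr 1
        simp
      have h3 : ∑ i, (q i : ℚ) * b i x = D * ∑ i : S, c (Sum.inr i) * b i x := by
        rw [Finset.mul_sum, ← Finset.sum_subset (Finset.subset_univ S), ← Finset.sum_coe_sort S]
        · refine Finset.sum_congr rfl fun i _ => ?_
          simp only [q, dif_pos i.2, hu, mul_assoc]
        · intro i _ hi
          simp [q, dif_neg hi]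
      rw [h2, h3, ← mul_add]
      congr 1
      linarith
    have hdeg : ∑ i, p i = ∑ i, q i := by
      have := hpq (1, 0)
      simp only [hb, Pi.zero_apply, mul_zero, Finset.sum_const_zero, add_zero, mul_one] at this
      exact_mod_cast this
    have hvec : ∑ i, p i • a i = ∑ i, q i • a i := by
      funext j
      have := hpq (0, Pi.single j 1)
      simp only [hb, zero_add, Pi.single_apply, mul_ite, mul_one, mul_zero, Finset.sum_ite_eq',
        Finset.mem_univ, if_true] at this
      simp only [Finset.sum_apply, nsmul_eq_mul]
      exact_mod_cast this
    have hprod := prod_rep_pow_eq hξ id p q hdeg hvec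
    have hq : ∏ i, ξ.rep i ^ q i ≠ 0 := by
      refine Finset.prod_ne_zero_iff.2 fun i _ => ?_
      by_cases hi : i ∈ S
      · exact pow_ne_zero _ (mem_coordSupport.1 hi)
      · simp [q, dif_neg hi]
    have hp : ∏ i, ξ.rep i ^ p i = 0 := by
      refine Finset.prod_eq_zero (Finset.mem_univ k) ?_
      rw [hS, mem_coordSupport, not_not] at hk
      rw [hk, zero_pow]
      simp only [p, if_true]
      omega
    exact hq (hprod.symm.trans hp)
  choose! x hx0 hxS hxk using hsep
  let y := ∑ k ∈ Sᶜ, x k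
  have hby : ∀ i, b i y = ∑ k ∈ Sᶜ, b i (x k) := fun i => map_sum _ _ _
  have hnonneg : ∀ i, 0 ≤ b i y := fun i => by
    rw [hby]
    exact Finset.sum_nonneg fun k hk => hx0 k (Finset.mem_compl.1 hk) i
  have hiff : ∀ i, i ∈ S ↔ b i y = 0 := by
    intro i
    refine ⟨fun hi => ?_, fun h => ?_⟩
    · rw [hby]
      exact Finset.sum_eq_zero fun k hk => hxS k (Finset.mem_compl.1 hk) i hi
    · by_contra hi
      refine h.not_gt ?_
      rw [hby]
      exact Finset.sum_pos' (fun k hk => hx0 k (Finset.mem_compl.1 hk) i)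
        ⟨i, Finset.mem_compl.2 hi, hxk i hi⟩
  let l : (Fin n → ℝ) →ₗ[ℝ] ℝ := -∑ j, (y.2 j : ℝ) • LinearMap.proj j
  have hl : ∀ i, l (realPoint a i) = y.1 - (b i y : ℚ) := by
    intro i
    simp [l, hb, realPoint, mul_comm]
  refine ⟨coordSupport_nonempty ξ, l, y.1, fun i => ?_, fun i => ?_⟩
  · rw [hl, sub_le_self_iff]
    exact_mod_cast hnonneg i
  · rw [hl, hiff, sub_eq_self]
    norm_cast

theorem realPoint_injective {a : Fin (N + 1) → Fin n → ℤ} (ha : Function.Injective a) :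
    Function.Injective (realPoint a) := by
  intro i k h
  refine ha (funext fun j => ?_)
  have := congrFun h j
  simpa [realPoint] using this

/-- The part of the polytope on which a functional takes its maximum has the same affine hull as
the vectors `a_i` in it. -/
theorem vectorSpan_face_eq {a : Fin (N + 1) → Fin n → ℤ} {F : Finset (Fin (N + 1))}
    {l : (Fin n → ℝ) →ₗ[ℝ] ℝ} {m : ℝ} (hF : F.Nonempty)
    (hle : ∀ i, l (realPoint a i) ≤ m) (hiff : ∀ i, i ∈ F ↔ l (realPoint a i) = m) :
    {x ∈ polytope a | ∀ y ∈ polytope a, l y ≤ l x} ∩ realPoints a = realPoint a '' F ∧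
      vectorSpan ℝ {x ∈ polytope a | ∀ y ∈ polytope a, l y ≤ l x} =
        vectorSpan ℝ (realPoint a '' (F : Set (Fin (N + 1)))) := by
  have hpt : ∀ i, realPoint a i ∈ polytope a := fun i => subset_convexHull ℝ _ ⟨i, rfl⟩
  have hmax : ∀ y ∈ polytope a, l y ≤ m ∧
      (l y = m → y ∈ affineSpan ℝ (realPoint a '' (F : Set (Fin (N + 1))))) := by
    -- A proper convex combination attains the maximum only if both of its points do.
    have hconv : Convex ℝ {y | l y ≤ m ∧
        (l y = m → y ∈ affineSpan ℝ (realPoint a '' (F : Set (Fin (N + 1)))))} := by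
      rw [convex_iff_forall_pos]
      rintro y ⟨hy, hy'⟩ z ⟨hz, hz'⟩ s t hs ht hst
      have hym := mul_le_mul_of_nonneg_left hy hs.le
      have hzm := mul_le_mul_of_nonneg_left hz ht.le
      have hm : s * m + t * m = m := by rw [← add_mul, hst, one_mul]
      have hlst : l (s • y + t • z) = s * l y + t * l z := by simp
      refine ⟨by rw [hlst]; linarith, fun h => ?_⟩
      rw [hlst] at h
      have h1 : s * l y = s * m := by linarith
      have h2 : t * l z = t * m := by linarith
      exact (affineSpan ℝ (realPoint a '' (F : Set (Fin (N + 1))))).convex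
        (hy' (mul_left_cancel₀ hs.ne' h1)) (hz' (mul_left_cancel₀ ht.ne' h2)) hs.le ht.le hst
    refine fun y hy => convexHull_min ?_ hconv hy
    rintro _ ⟨i, rfl⟩
    exact ⟨hle i, fun h => subset_affineSpan ℝ _ ⟨i, (hiff i).2 h, rfl⟩⟩
  obtain ⟨k, hk⟩ := hF
  have hface : {x ∈ polytope a | ∀ y ∈ polytope a, l y ≤ l x} = {x ∈ polytope a | l x = m} := by
    ext x
    refine and_congr_right fun hx => ⟨fun h => ?_, fun h y hy => ?_⟩
    · exact (hmax x hx).1.antisymm ((hiff k).1 hk ▸ h _ (hpt k))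
    · rw [h]
      exact (hmax y hy).1
  rw [hface]
  refine ⟨?_, le_antisymm ?_ (vectorSpan_mono ℝ ?_)⟩
  · ext x
    constructor
    · rintro ⟨⟨-, hx⟩, ⟨i, rfl⟩⟩
      exact ⟨i, (hiff i).2 hx, rfl⟩
    · rintro ⟨i, hi, rfl⟩
      exact ⟨⟨hpt i, (hiff i).1 hi⟩, ⟨i, rfl⟩⟩
  · rw [← direction_affineSpan ℝ (realPoint a '' (F : Set (Fin (N + 1)))),
      AffineSubspace.direction_eq_vectorSpan]
    exact vectorSpan_mono ℝ fun x hx => (hmax x hx.1).2 hx.2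
  · rintro _ ⟨i, hi, rfl⟩
    exact ⟨hpt i, (hiff i).1 hi⟩

/-- The faces of the polytope correspond to the sets of indices on which a linear functional is
maximal, with the same dimension and the same number of points. -/
theorem minFaceCard_eq_sInf_card {a : Fin (N + 1) → Fin n → ℤ} (ha : Function.Injective a) (j : ℕ) :
    minFaceCard a j = sInf {m | ∃ F, IsIndexFace a F ∧ affineDim a F = j ∧ m = F.card} := by
  classical
  have hcard : ∀ F : Finset (Fin (N + 1)), (realPoint a '' (F : Set (Fin (N + 1)))).ncard = F.card :=
    fun F => by rw [Set.ncard_image_of_injective _ (realPoint_injective ha), Set.ncard_coe_finset]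
  rw [minFaceCard]
  congr 1
  ext m
  constructor
  · rintro ⟨P, ⟨hP, hexp⟩, hdim, rfl⟩
    obtain ⟨l, rfl⟩ := hexp hP
    obtain ⟨k, -, hmax⟩ := Finset.univ.exists_max_image (fun i => l (realPoint a i))
      Finset.univ_nonempty
    let F := Finset.univ.filter fun i => l (realPoint a i) = l (realPoint a k)
    have hF : F.Nonempty := ⟨k, by simp [F]⟩
    obtain ⟨h1, h2⟩ := vectorSpan_face_eq (l := (l : (Fin n → ℝ) →ₗ[ℝ] ℝ)) hF
      (fun i => hmax i (Finset.mem_univ i)) (fun i => by simp [F])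
    refine ⟨F, ⟨hF, l, _, fun i => hmax i (Finset.mem_univ i), fun i => by simp [F]⟩, ?_, ?_⟩
    · rw [← hdim, affineDim, ← h2]
      rfl
    · rw [← hcard, ← h1]
      rfl
  · rintro ⟨F, ⟨hF, l, m, hle, hiff⟩, hdim, rfl⟩
    obtain ⟨h1, h2⟩ := vectorSpan_face_eq hF hle hiff
    refine ⟨{x ∈ polytope a | ∀ y ∈ polytope a, l y ≤ l x}, ⟨?_, fun _ => ?_⟩, ?_, ?_⟩
    · have : (realPoint a '' (F : Set (Fin (N + 1)))).Nonempty := hF.to_set.image _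
      rw [← h1] at this
      exact this.mono Set.inter_subset_left
    · exact ⟨LinearMap.toContinuousLinearMap l, rfl⟩
    · rw [h2, ← hdim]
      rfl
    · rw [h1, hcard]

theorem minFaceCard_le_card {a : Fin (N + 1) → Fin n → ℤ} (ha : Function.Injective a)
    {F : Finset (Fin (N + 1))} (hF : IsIndexFace a F) : minFaceCard a (affineDim a F) ≤ F.card := by
  rw [minFaceCard_eq_sInf_card ha]
  exact Nat.sInf_le ⟨F, hF, rfl, rfl⟩

theorem exists_isIndexFace_card_eq_minFaceCard {a : Fin (N + 1) → Fin n → ℤ}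
    (ha : Function.Injective a) {j : ℕ} (hj : j ≤ affineDim a (Set.univ : Set (Fin (N + 1)))) :
    ∃ F, IsIndexFace a F ∧ affineDim a F = j ∧ F.card = minFaceCard a j := by
  rw [minFaceCard_eq_sInf_card ha]
  obtain ⟨F, hF, hdim, hcard⟩ := Nat.sInf_mem
    (s := {m | ∃ F, IsIndexFace a F ∧ affineDim a F = j ∧ m = F.card}) (by
      obtain ⟨G, -, hG, hdim⟩ := (isIndexFace_univ a).exists_subface (j := j) (by simpa using hj)
      exact ⟨_, G, hG, hdim, rfl⟩)
  exact ⟨F, hF, hdim, hcard.symm⟩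

/-- The rank of the lattice of differences is the dimension of the polytope. -/
theorem latticeDim_eq_affineDim (a : Fin (N + 1) → Fin n → ℤ) :
    latticeDim a = affineDim a (Set.univ : Set (Fin (N + 1))) := by
  classical
  apply le_antisymm
  -- A lattice basis is linearly independent over the real numbers.
  · let B := Module.finBasis ℤ (differenceLattice a)
    have hZ : LinearIndependent ℤ fun m => (B m : Fin n → ℤ) :=
      B.linearIndependent.map' (differenceLattice a).subtype (Submodule.ker_subtype _)
    have hR := (linearIndependent_algebraMap_comp_iff (S := ℝ)).2 hZ
    have hcast : ∀ x ∈ differenceLattice a, (algebraMap ℤ ℝ ∘ x) ∈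
        vectorSpan ℝ (realPoint a '' (Set.univ : Set (Fin (N + 1)))) := by
      intro x hx
      induction hx using Submodule.span_induction with
      | mem x hx =>
        obtain ⟨i, k, rfl⟩ := hx
        have := vsub_mem_vectorSpan ℝ (Set.mem_image_of_mem (realPoint a) (Set.mem_univ i))
          (Set.mem_image_of_mem (realPoint a) (Set.mem_univ k))
        convert this using 1
        ext j
        simp [realPoint]
      | zero =>
        convert Submodule.zero_mem _ using 1
        ext j
        simp
      | add x y _ _ hx hy =>
        convert Submodule.add_mem _ hx hy using 1
        ext j
        simp
      | smul c x _ hx =>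
        convert Submodule.smul_mem _ (c : ℝ) hx using 1
        ext j
        simp
    have h1 := finrank_span_eq_card hR
    rw [Fintype.card_fin] at h1
    rw [latticeDim, ← h1]
    refine Submodule.finrank_mono (Submodule.span_le.2 ?_)
    rintro _ ⟨m, rfl⟩
    exact hcast _ (B m).2
  -- Vectors on which integral functionals form a diagonal matrix are linearly independent.
  · have h := exists_integral_coordinates a (F := Finset.univ) Finset.univ_nonempty
    rw [Finset.coe_univ] at h
    obtain ⟨i₀, -, i, -, L, d, hd, hL⟩ := h
    let v : Fin (affineDim a (Set.univ : Set (Fin (N + 1)))) → differenceLattice a := fun m =>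
      ⟨a (i m) - a i₀, Submodule.subset_span ⟨_, _, rfl⟩⟩
    have hv : LinearIndependent ℤ v := by
      rw [Fintype.linearIndependent_iff]
      intro c hc m
      have h1 : ∀ b, ∑ k, c k * (a (i k) b - a i₀ b) = 0 := fun b => by
        have := congrFun (congrArg Subtype.val hc) b
        simpa [v] using this
      have h2 : ∑ b, L m b * ∑ k, c k * (a (i k) b - a i₀ b) = c m * d := by
        simp only [Finset.mul_sum]
        rw [Finset.sum_comm]
        have : ∀ k, ∑ b, L m b * (c k * (a (i k) b - a i₀ b)) = c k * if m = k then d else 0 := by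
          intro k
          rw [← hL m k, ← Finset.sum_sub_distrib, Finset.mul_sum]
          exact Finset.sum_congr rfl fun b _ => by ring
        rw [Finset.sum_congr rfl fun k _ => this k]
        simp
      simp only [h1, mul_zero, Finset.sum_const_zero] at h2
      exact (mul_eq_zero.1 h2.symm).resolve_right hd
    rw [latticeDim]
    simpa using hv.fintype_card_le_finrank

/-! ### Successive minima -/

/-- A closed subset of the toric variety that contains the torsion points of the orbit of `F`, and
all of whose supports have at most the affine dimension of `F`, has the dimension of `F`. -/
theorem zdim_eq_affineDim {a : Fin (N + 1) → Fin n → ℤ} {F : Finset (Fin (N + 1))}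
    (hF : F.Nonempty) {W : Set (ProjSpace N)} (hW : IsClosed W) (hWa : W ⊆ toricVariety a)
    (hd : ∀ x ∈ W, affineDim a (coordSupport x) ≤ affineDim a F)
    (hFW : ∀ t : Fin n → Qbarˣ, (∀ b, IsOfFinOrder (t b)) → facePoint a hF t ∈ W) :
    zdim W = affineDim a F := by
  have h1 := topologicalKrullDim_le hW hWa hd
  have h2 := affineDim_le_topologicalKrullDim a hF hW hFW
  have hne : W.Nonempty := ⟨_, hFW 1 fun _ => .one⟩
  exact (zdim_le_of_topologicalKrullDim_le h1).antisymm
    (le_zdim_of_le_topologicalKrullDim h1 (by exact_mod_cast h2) hne)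

theorem zdim_toricVariety (a : Fin (N + 1) → Fin n → ℤ) :
    zdim (toricVariety a) = latticeDim a := by
  rw [latticeDim_eq_affineDim, ← Finset.coe_univ]
  refine zdim_eq_affineDim (Finset.univ_nonempty) (isClosed_toricVariety a) subset_rfl
    (fun x _ => affineDim_mono a (by simp)) fun t _ =>
      facePoint_mem_toricVariety (isIndexFace_univ a) t

/-- The union of the orbits of dimension less than `j` of the toric variety, where the orbit of a
point is identified by the support of the point. -/
def smallOrbits (a : Fin (N + 1) → Fin n → ℤ) (j : ℕ) : Set (ProjSpace N) :=
  {x ∈ toricVariety a | affineDim a (coordSupport x) < j}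

theorem isClosed_affineDim_coordSupport_lt (a : Fin (N + 1) → Fin n → ℤ) (j : ℕ) :
    IsClosed {x : ProjSpace N | affineDim a (coordSupport x) < j} := by
  refine isClosed_iff_isAlgebraicSet.2
    ⟨{f | ∃ S : Finset (Fin (N + 1)), j ≤ affineDim a S ∧ f = ∏ i ∈ S, MvPolynomial.X i}, ?_, ?_⟩
  · rintro _ ⟨S, -, rfl⟩
    exact ⟨_, MvPolynomial.IsHomogeneous.prod _ _ (fun _ => 1)
      fun i _ => MvPolynomial.isHomogeneous_X _ i⟩
  · ext x
    constructor
    · rintro hx _ ⟨S, hS, rfl⟩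
      rw [map_prod]
      by_contra hne
      replace hne := Finset.prod_ne_zero_iff.1 hne
      refine (hS.trans (affineDim_mono a fun i hi => ?_)).not_gt hx
      simpa using hne i hi
    · intro hx
      by_contra hcon
      have := hx _ ⟨coordSupport x, not_lt.1 hcon, rfl⟩
      rw [map_prod, Finset.prod_eq_zero_iff] at this
      obtain ⟨i, hi, hi0⟩ := this
      rw [MvPolynomial.eval_X] at hi0
      exact mem_coordSupport.1 hi hi0

theorem zdim_smallOrbits (a : Fin (N + 1) → Fin n → ℤ) {j : ℕ} (hj : j ≤ latticeDim a) :
    zdim (smallOrbits a j) = j - 1 := by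
  rcases j with _ | j
  · have : smallOrbits a 0 = ∅ := by
      ext x
      simp [smallOrbits]
    rw [this, zdim, if_pos rfl]
    simp
  · rw [latticeDim_eq_affineDim, ← Finset.coe_univ] at hj
    obtain ⟨F, -, hF, hdim⟩ := (isIndexFace_univ a).exists_subface (j := j) (by omega)
    have hclosed : IsClosed (smallOrbits a (j + 1)) :=
      (isClosed_toricVariety a).inter (isClosed_affineDim_coordSupport_lt a (j + 1))
    rw [zdim_eq_affineDim hF.1 hclosed
      (fun x hx => hx.1) (fun x hx => ?_) (fun t _ => ⟨facePoint_mem_toricVariety hF t, ?_⟩), hdim]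
    · simp
    · have : affineDim a (coordSupport x) < j + 1 := hx.2
      omega
    · rw [coordSupport_facePoint]
      omega

theorem successiveMinimum_toricVariety {a : Fin (N + 1) → Fin n → ℤ} (ha : Function.Injective a)
    {i : ℕ} (hi1 : 1 ≤ i) (hi : i ≤ latticeDim a + 1) :
    successiveMinimum (toricVariety a) i =
      ((1 / 2 * Real.log (minFaceCard a (latticeDim a + 1 - i) : ℝ) : ℝ) : EReal) := by
  set j := latticeDim a + 1 - i with hj
  have hjr : j ≤ latticeDim a := by omega
  obtain ⟨F, hF, hdim, hcard⟩ := exists_isIndexFace_card_eq_minFaceCard ha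
    (j := j) (by rwa [← latticeDim_eq_affineDim])
  apply le_antisymm
  · refine iSup₂_le fun W hW => ?_
    obtain ⟨⟨Z, hZ, rfl⟩, hcodim⟩ := hW
    rw [zdim_toricVariety] at hcodim
    -- The torsion points of the orbit of `F` are too many to lie in a set of this dimension.
    obtain ⟨t, ht, htW⟩ : ∃ t : Fin n → Qbarˣ, (∀ b, IsOfFinOrder (t b)) ∧
        facePoint a hF.1 t ∉ toricVariety a ∩ Z := by
      by_contra! hcon
      have hclosed := (isClosed_toricVariety a).inter hZ
      have h1 : topologicalKrullDim ↥(toricVariety a ∩ Z) ≤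
          (affineDim a (Set.univ : Set (Fin (N + 1))) : ℕ) :=
        topologicalKrullDim_le hclosed Set.inter_subset_left
          fun x _ => affineDim_mono a (Set.subset_univ _)
      have h2 := affineDim_le_topologicalKrullDim a hF.1 hclosed hcon
      have h3 := le_zdim_of_le_topologicalKrullDim h1 (by exact_mod_cast h2)
        ⟨_, hcon 1 fun _ => .one⟩
      omega
    refine iInf₂_le_of_le (facePoint a hF.1 t) ⟨facePoint_mem_toricVariety hF t, htW⟩ ?_
    rw [height_facePoint a hF.1 ht, hcard]
  · refine le_iSup₂_of_le (smallOrbits a j) ⟨⟨_, isClosed_affineDim_coordSupport_lt a j, rfl⟩, ?_⟩ ?_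
    · rw [zdim_smallOrbits a hjr, zdim_toricVariety]
      omega
    · refine le_iInf₂ fun ξ hξ => EReal.coe_le_coe_iff.2 ?_
      have hdimξ : j ≤ affineDim a (coordSupport ξ) :=
        not_lt.1 fun h => hξ.2 ⟨hξ.1, h⟩
      obtain ⟨G, hGξ, hG, hGj⟩ := (isIndexFace_coordSupport hξ.1).exists_subface hdimξ
      refine le_trans ?_ (half_log_card_coordSupport_le_height ξ)
      have hle := (minFaceCard_le_card ha hG).trans (Finset.card_le_card hGξ)
      rw [hGj] at hle
      have hpos : 0 < minFaceCard a j := by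
        rw [← hcard]
        exact Finset.card_pos.2 hF.1
      have := Real.log_le_log (by exact_mod_cast hpos) (Nat.cast_le (α := ℝ).2 hle)
      linarith

theorem minFaceCard_latticeDim {a : Fin (N + 1) → Fin n → ℤ} (ha : Function.Injective a) :
    minFaceCard a (latticeDim a) = N + 1 := by
  rw [latticeDim_eq_affineDim]
  obtain ⟨F, ⟨⟨k, hk⟩, l, m, hle, hiff⟩, hdim, hcard⟩ :=
    exists_isIndexFace_card_eq_minFaceCard ha (le_refl (affineDim a (Set.univ : Set (Fin (N + 1)))))
  have hspan : vectorSpan ℝ (realPoint a '' (F : Set (Fin (N + 1)))) =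
      vectorSpan ℝ (realPoint a '' Set.univ) :=
    Submodule.eq_of_le_of_finrank_eq (vectorSpan_mono ℝ (Set.image_mono (Set.subset_univ _))) hdim
  have hker : vectorSpan ℝ (realPoint a '' Set.univ) ≤ LinearMap.ker l :=
    hspan ▸ le_ker_of_eq_const fun i hi => (hiff i).1 hi
  have hF : F = Finset.univ := Finset.eq_univ_of_forall fun i => by
    rw [hiff, eq_of_le_ker hker (Set.mem_univ i) (Set.mem_univ k), ← hiff]
    exact hk
  rw [← hcard, hF, Finset.card_univ, Fintype.card_fin]

theorem minFaceCard_zero {a : Fin (N + 1) → Fin n → ℤ} (ha : Function.Injective a) :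
    minFaceCard a 0 = 1 := by
  obtain ⟨F, hF, hdim, hcard⟩ := exists_isIndexFace_card_eq_minFaceCard ha (Nat.zero_le _)
  rw [← hcard]
  refine le_antisymm (Finset.card_le_one.2 fun i hi k hk => realPoint_injective ha ?_)
    (Finset.card_pos.2 hF.1)
  have := vsub_mem_vectorSpan ℝ (Set.mem_image_of_mem (realPoint a) (Finset.mem_coe.2 hi))
    (Set.mem_image_of_mem (realPoint a) (Finset.mem_coe.2 hk))
  rw [Submodule.finrank_eq_zero.1 hdim, Submodule.mem_bot] at this
  exact sub_eq_zero.1 this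

end ToricMinima

end

theorem mainTheorem1 (n N : ℕ) (a : Fin (N + 1) → Fin n → ℤ) (ha : Function.Injective a) :
    (∀ i : ℕ, 1 ≤ i → i ≤ ToricMinima.latticeDim a + 1 →
      ToricMinima.successiveMinimum (ToricMinima.toricVariety a) i =
        ((1 / 2 * Real.log
          (ToricMinima.minFaceCard a (ToricMinima.latticeDim a + 1 - i) : ℝ) : ℝ) : EReal)) ∧
    ToricMinima.essentialMinimum (ToricMinima.toricVariety a) =
      ((1 / 2 * Real.log ((N : ℝ) + 1) : ℝ) : EReal) ∧
    ToricMinima.absoluteMinimum (ToricMinima.toricVariety a) = 0 := by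
  refine ⟨fun i hi1 hi => ToricMinima.successiveMinimum_toricVariety ha hi1 hi, ?_, ?_⟩
  · rw [ToricMinima.essentialMinimum,
      ToricMinima.successiveMinimum_toricVariety ha le_rfl (Nat.le_add_left _ _),
      Nat.add_sub_cancel, ToricMinima.minFaceCard_latticeDim ha, Nat.cast_add, Nat.cast_one]
  · have h : (ToricMinima.zdim (ToricMinima.toricVariety a) + 1).toNat =
        ToricMinima.latticeDim a + 1 := by
      rw [ToricMinima.zdim_toricVariety]
      omega
    rw [ToricMinima.absoluteMinimum, h,
      ToricMinima.successiveMinimum_toricVariety ha (Nat.le_add_left _ _) le_rfl, Nat.sub_self,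
      ToricMinima.minFaceCard_zero ha]
    simp
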